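/- Let $G$ be a finite, compact metric graph (not necessarily connected): finitely many intervals $I_j=[0,L_j]$, $L_j>0$, $j=1,\dots,r$ (the edges), with an equivalence relation on the set of their endpoints, whose classes $v_1,\dots,v_s$ are the vertices. Loops and multiple edges are allowed. Write $o(I_j)$ and $t(I_j)$ for the vertices containing the endpoints $0$ and $L_j$ of $I_j$. The degree of a vertex is the number of edge endpoints in it; boundary vertices are the vertices of degree one. The core of $G$ is the largest subgraph of $G$ without vertices of degree one, and a vertex is a proper core vertex if all edges attached to it belong to the core. Let $q_j\in L^1(I_j)$ be real-valued and let $\alpha\in\mathbb{R}^s$. For $f=(f_j)_j$ put $(\mathcal{L}f)_j=-f_j''+q_jf_j$ and $$\partial_\nu f(v_i)=\sum_{t(I_j)=v_i}f_j'(L_j)-\sum_{o(I_j)=v_i}f_j'(0).$$ Let $AC^2(G)$ be the set of $f$ such that all $f_j,f_j'$ are absolutely continuous, and call $f$ continuous on $G$ if, moreover, the $f_j$ are continuous and their values at endpoints belonging to the same vertex coincide. In $L^2(G)=\bigoplus_jL^2(I_j)$ let $A_\alpha f=\mathcal{L}f$ with domain the set of $f\in L^2(G)\cap AC^2(G)$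 that are continuous on $G$ and satisfy $\mathcal{L}f\in L^2(G)$ and $\partial_\nu f(v_i)-\alpha_if(v_i)=0$ for $i=1,\dots,s$. Let $B$ be a set of vertices of $G$ which contains all boundary vertices and all proper core vertices of $G$. For $\mu\in\mathbb{C}\setminus\sigma(A_\alpha)$ let $M_{B,\alpha}(\mu)$ be the matrix with rows and columns indexed by $B$ and entries $(M_{B,\alpha}(\mu))_{v,w}=f^{(w)}(v)$, where $f^{(w)}\in AC^2(G)$ is the unique function which is continuous on $G$ and satisfies $\mathcal{L}f^{(w)}=\mu f^{(w)}$, $\partial_\nu f^{(w)}(w)-\alpha_wf^{(w)}(w)=1$, and $\partial_\nu f^{(w)}(v)-\alpha_vf^{(w)}(v)=0$ for all vertices $v\neq w$. Here $\alpha_v$ denotes the component of $\alpha$ belonging to the vertex $v$. A number $\lambda\in\mathbb{R}$ is called a resonance if there is a cycle in $G$ (a loop, a pair of parallel edges, or a longer simple cycle) such that, for each edge $I_j$ of the cycle, $\lambda$ is an eigenvalue of $-\frac{d^2}{dx^2}+q_j$ in $L^2(I_j)$ with Dirichlet boundary conditions at both endpoints. Then for each $\lambda\in\mathbb{R}$ which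 is not a resonance the following assertions hold. (i) $\lambda$ is an eigenvalue of $A_\alpha$ if and only if $\lambda$ is a pole (of positive order) of the matrix function $M_{B,\alpha}$. (ii) $\dim\ker(A_\alpha-\lambda)=\operatorname{rank}\operatorname{Res}_\lambda M_{B,\alpha}$, where $\operatorname{Res}_\lambda M_{B,\alpha}=\frac{1}{2\pi i}\oint M_{B,\alpha}(\mu)\,d\mu$ over small circles around $\lambda$ (so that it is $0$ if $M_{B,\alpha}$ is analytic at $\lambda$ or can be continued analytically into $\lambda$). -/

import Mathlib

open MeasureTheory Filter Topology Set
open scoped ENNReal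

/-- A finite, compact metric graph with edge set `E` and vertex set `V` (both finite wherever it is
used). The edge `e` is the interval `[0, len e]`, glued with its endpoint `0` to the vertex `o e`
and with its endpoint `len e` to the vertex `t e`. Loops and multiple edges are allowed and the graph
may be disconnected. Vertices are classes of edge endpoints: each vertex is an endpoint of some
edge. -/
structure MetricGraph (V E : Type*) where
  len : E → ℝ
  len_pos : ∀ e, 0 < len e
  o : E → V
  t : E → V
  exists_endpoint : Function.Surjective (Sum.elim o t)

/-! ### Schroedinger equation on one interval -/

/-- The derivative of `f` on `[0, L]`, one-sided at the two endpoints. -/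
noncomputable def edgeDeriv (L : ℝ) (f : ℝ → ℂ) : ℝ → ℂ :=
  derivWithin f (Icc 0 L)

/-- `f` and `f'` are (defined and) absolutely continuous on `[0, L]`. Values outside `[0, L]` play
no role. -/
structure IsAC2 (L : ℝ) (f : ℝ → ℂ) : Prop where
  differentiable : DifferentiableOn ℝ f (Icc 0 L)
  ac : AbsolutelyContinuousOnInterval f 0 L
  ac_deriv : AbsolutelyContinuousOnInterval (edgeDeriv L f) 0 L

/-- `-f'' + q f = w` almost everywhere on `[0, L]`, written as `f'' = q f - w`. -/
def SchrodingerEq (L : ℝ) (q : ℝ → ℝ) (f w : ℝ → ℂ) : Prop :=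
  ∀ᵐ x ∂(volume.restrict (Icc 0 L)), HasDerivAt (edgeDeriv L f) ((q x : ℂ) * f x - w x) x

theorem AbsolutelyContinuousOnInterval.congr_Icc {f g : ℝ → ℂ} {L : ℝ} (hL : 0 ≤ L)
    (hf : AbsolutelyContinuousOnInterval f 0 L) (h : EqOn g f (Icc 0 L)) :
    AbsolutelyContinuousOnInterval g 0 L := by
  rw [absolutelyContinuousOnInterval_iff] at hf ⊢
  intro ε hε
  obtain ⟨δ, hδ, H⟩ := hf ε hε
  refine ⟨δ, hδ, fun I hI hlen => ?_⟩
  have hsum := H I hI hlen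
  have heq : ∑ i ∈ Finset.range I.1, dist (g (I.2 i).1) (g (I.2 i).2) =
      ∑ i ∈ Finset.range I.1, dist (f (I.2 i).1) (f (I.2 i).2) := by
    refine Finset.sum_congr rfl fun i hi => ?_
    have hm := hI.1 i hi
    rw [uIcc_of_le hL] at hm
    rw [h hm.1, h hm.2]
  rwa [heq]

theorem edgeDeriv_add {L : ℝ} {f g : ℝ → ℂ} (hf : DifferentiableOn ℝ f (Icc 0 L))
    (hg : DifferentiableOn ℝ g (Icc 0 L)) :
    EqOn (edgeDeriv L (f + g)) (edgeDeriv L f + edgeDeriv L g) (Icc 0 L) := fun x hx =>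
  derivWithin_add (hf x hx) (hg x hx)

theorem edgeDeriv_smul {L : ℝ} (c : ℂ) (f : ℝ → ℂ) :
    edgeDeriv L (c • f) = c • edgeDeriv L f := by
  funext x
  exact derivWithin_const_smul_field c f

theorem IsAC2.add {L : ℝ} (hL : 0 ≤ L) {f g : ℝ → ℂ} (hf : IsAC2 L f) (hg : IsAC2 L g) :
    IsAC2 L (f + g) :=
  ⟨hf.1.add hg.1, hf.2.add hg.2,
    (hf.3.add hg.3).congr_Icc hL (edgeDeriv_add hf.1 hg.1)⟩

theorem IsAC2.smul {L : ℝ} (c : ℂ) {f : ℝ → ℂ} (hf : IsAC2 L f) : IsAC2 L (c • f) := by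
  refine ⟨hf.1.const_smul c, hf.2.const_smul c, ?_⟩
  rw [edgeDeriv_smul]
  exact hf.3.const_smul c

theorem ae_mem_Ioo (L : ℝ) : ∀ᵐ x ∂(volume.restrict (Icc 0 L) : Measure ℝ), x ∈ Ioo 0 L := by
  rw [← restrict_Ioo_eq_restrict_Icc]
  exact ae_restrict_mem measurableSet_Ioo

theorem SchrodingerEq.add {L : ℝ} {q : ℝ → ℝ} {f g w z : ℝ → ℂ} (hf : IsAC2 L f)
    (hg : IsAC2 L g) (h : SchrodingerEq L q f w) (h' : SchrodingerEq L q g z) :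
    SchrodingerEq L q (f + g) (w + z) := by
  filter_upwards [h, h', ae_mem_Ioo L] with x hx hx' hm
  have heq : edgeDeriv L (f + g) =ᶠ[𝓝 x] edgeDeriv L f + edgeDeriv L g :=
    (edgeDeriv_add hf.1 hg.1).eventuallyEq_of_mem (Icc_mem_nhds hm.1 hm.2)
  refine ((hx.add hx').congr_of_eventuallyEq heq).congr_deriv ?_
  simp only [Pi.add_apply]
  ring

theorem SchrodingerEq.smul {L : ℝ} {q : ℝ → ℝ} (c : ℂ) {f w : ℝ → ℂ}
    (h : SchrodingerEq L q f w) : SchrodingerEq L q (c • f) (c • w) := by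
  filter_upwards [h] with x hx
  rw [edgeDeriv_smul]
  refine (hx.const_smul c).congr_deriv ?_
  simp only [Pi.smul_apply, smul_eq_mul]
  ring

theorem SchrodingerEq.congr {L : ℝ} {q : ℝ → ℝ} {f w z : ℝ → ℂ}
    (h : SchrodingerEq L q f w) (hz : z =ᵐ[volume.restrict (Icc 0 L)] w) :
    SchrodingerEq L q f z := by
  filter_upwards [h, hz] with x hx hzx
  rwa [hzx]

theorem SchrodingerEq.eq_zero {L : ℝ} (hL : 0 < L) {q : ℝ → ℝ} {f w : ℝ → ℂ} (hf : IsAC2 L f)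
    (h : SchrodingerEq L q f w) (h0 : f =ᵐ[volume.restrict (Icc 0 L)] 0) :
    w =ᵐ[volume.restrict (Icc 0 L)] 0 := by
  have hz : EqOn f 0 (Icc 0 L) :=
    Measure.eqOn_Icc_of_ae_eq volume hL.ne h0 hf.1.continuousOn continuousOn_const
  have hd : EqOn (edgeDeriv L f) 0 (Icc 0 L) := fun x hx => by
    have : edgeDeriv L f x = derivWithin (fun _ => (0 : ℂ)) (Icc 0 L) x :=
      derivWithin_congr hz (hz hx)
    simpa using this
  filter_upwards [h, ae_mem_Ioo L] with x hx hm
  have heq : edgeDeriv L f =ᶠ[𝓝 x] fun _ => 0 :=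
    hd.eventuallyEq_of_mem (Icc_mem_nhds hm.1 hm.2)
  have h2 := hx.unique ((hasDerivAt_const x (0 : ℂ)).congr_of_eventuallyEq heq)
  have hfx : f x = 0 := hz (Ioo_subset_Icc_self hm)
  simpa [hfx] using h2

namespace MetricGraph

variable {V E : Type*} (G : MetricGraph V E)

/-! ### Combinatorics -/

/-- The vertex to which an edge endpoint belongs: `Sum.inl e` is the endpoint `0` of `e` and
`Sum.inr e` is the endpoint `len e`. -/
def vertexOf : E ⊕ E → V := Sum.elim G.o G.t

/-- Degree of `v`: the number of edge endpoints at `v` (a loop counts twice). -/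
noncomputable def degree (v : V) : ℕ := Set.ncard {p : E ⊕ E | G.vertexOf p = v}

/-- The boundary vertices are the vertices of degree one. -/
def IsBoundary (v : V) : Prop := G.degree v = 1

/-- Degree of `v` in the subgraph formed by the edges in `S`. -/
noncomputable def degreeIn (S : Set E) (v : V) : ℕ :=
  Set.ncard {p : E ⊕ E | G.vertexOf p = v ∧ Sum.elim id id p ∈ S}

/-- The subgraph formed by the edges in `S` has no vertices of degree one. -/
def NoDegreeOne (S : Set E) : Prop := ∀ v, G.degreeIn S v ≠ 1

/-- The (edges of the) core: the largest subgraph without vertices of degree one. -/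
def core : Set E := ⋃₀ {S | G.NoDegreeOne S}


theorem noDegreeOne_core [Finite E] : G.NoDegreeOne G.core := by
  intro v hv
  obtain ⟨p, hp⟩ := Set.ncard_eq_one.1 hv
  have hpm : G.vertexOf p = v ∧ Sum.elim id id p ∈ G.core := by
    have h : p ∈ ({p} : Set (E ⊕ E)) := rfl
    rwa [← hp] at h
  obtain ⟨S, hS, hpS⟩ := hpm.2
  refine hS v (Set.ncard_eq_one.2 ⟨p, Set.eq_singleton_iff_unique_mem.2 ⟨⟨hpm.1, hpS⟩, ?_⟩⟩)
  intro p' hp'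
  have h : p' ∈ {p : E ⊕ E | G.vertexOf p = v ∧ Sum.elim id id p ∈ G.core} :=
    ⟨hp'.1, S, hS, hp'.2⟩
  rwa [hp] at h

/-- `v` is a proper core vertex if all edges attached to it belong to the core. -/
def IsProperCore (v : V) : Prop := ∀ e, G.o e = v ∨ G.t e = v → e ∈ G.core

/-- The distinct edges `e 0, …, e n` and the distinct vertices `v 0, …, v n` form a cycle: `e i`
joins `v i` to `v (i + 1)`, with indices modulo `n + 1`. A loop is a cycle with `n = 0`, two parallel
edges form a cycle with `n = 1`. -/
structure IsCycle (n : ℕ) (v : Fin (n + 1) → V) (e : Fin (n + 1) → E) : Prop where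
  vertex_injective : Function.Injective v
  edge_injective : Function.Injective e
  joins : ∀ i, (G.o (e i) = v i ∧ G.t (e i) = v (i + 1)) ∨
    (G.o (e i) = v (i + 1) ∧ G.t (e i) = v i)

/-! ### Functions on the graph -/

/-- Values of `f` at the edge endpoints. -/
def endValue (f : E → ℝ → ℂ) : E ⊕ E → ℂ :=
  Sum.elim (fun e => f e 0) (fun e => f e (G.len e))

/-- The values of `f` at any two endpoints belonging to the same vertex coincide. (For a function in
`AC²` this is continuity on the graph.) -/
def ContinuousAtVertices (f : E → ℝ → ℂ) : Prop :=
  ∀ p p' : E ⊕ E, G.vertexOf p = G.vertexOf p' → G.endValue f p = G.endValue f p'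

/-- The value `f (v)`, read off at an arbitrary edge endpoint at `v`. -/
noncomputable def vertexValue (f : E → ℝ → ℂ) (v : V) : ℂ :=
  G.endValue f (Function.surjInv G.exists_endpoint v)

open Classical in
/-- `∂_ν f (v)`. -/
noncomputable def normalDeriv [Fintype E] (f : E → ℝ → ℂ) (v : V) : ℂ :=
  (∑ e with G.t e = v, edgeDeriv (G.len e) (f e) (G.len e)) -
    ∑ e with G.o e = v, edgeDeriv (G.len e) (f e) 0

/-- `f` belongs to `AC²` of the graph and is continuous on it (hence it is in `L²`). -/
def IsContAC2 (f : E → ℝ → ℂ) : Prop :=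
  (∀ e, IsAC2 (G.len e) (f e)) ∧ G.ContinuousAtVertices f

/-- `L²(G)`, the orthogonal sum of the spaces `L²(0, len e)`. -/
abbrev L2 : Type _ :=
  PiLp 2 fun e : E => Lp ℂ 2 (volume.restrict (Icc 0 (G.len e)) : Measure ℝ)

/-- `(u, w)` is in the graph of the Schroedinger operator: the class `u` is represented by a function
`f` in `AC²` with `f` continuous on the graph, `∂_ν f (v) - α_v f (v) = 0` at all vertices, and
`-f_e'' + q_e f_e = w_e` on every edge, with `w` in `L²`. -/
def InSchrodingerGraph [Fintype E] (q : E → ℝ → ℝ) (α : V → ℝ) (u w : G.L2) : Prop :=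
  ∃ f : E → ℝ → ℂ, G.IsContAC2 f ∧
    (∀ v, G.normalDeriv f v - (α v : ℂ) * G.vertexValue f v = 0) ∧
    (∀ e, u e =ᵐ[volume.restrict (Icc 0 (G.len e))] f e) ∧
    ∀ e, SchrodingerEq (G.len e) (q e) (f e) (w e)

theorem normalDeriv_add [Fintype E] {f g : E → ℝ → ℂ} (hf : G.IsContAC2 f) (hg : G.IsContAC2 g)
    (v : V) : G.normalDeriv (f + g) v = G.normalDeriv f v + G.normalDeriv g v := by
  have key : ∀ e, ∀ x ∈ Icc 0 (G.len e), edgeDeriv (G.len e) ((f + g) e) x =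
      edgeDeriv (G.len e) (f e) x + edgeDeriv (G.len e) (g e) x := fun e x hx =>
    edgeDeriv_add (hf.1 e).1 (hg.1 e).1 hx
  simp only [normalDeriv, key _ _ (right_mem_Icc.2 (G.len_pos _).le),
    key _ _ (left_mem_Icc.2 (G.len_pos _).le), Finset.sum_add_distrib]
  ring

theorem normalDeriv_smul [Fintype E] (c : ℂ) (f : E → ℝ → ℂ) (v : V) :
    G.normalDeriv (c • f) v = c * G.normalDeriv f v := by
  simp only [normalDeriv, Pi.smul_apply, edgeDeriv_smul, smul_eq_mul, mul_sub, Finset.mul_sum]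

theorem endValue_add (f g : E → ℝ → ℂ) (p : E ⊕ E) :
    G.endValue (f + g) p = G.endValue f p + G.endValue g p := by
  cases p <;> rfl

theorem endValue_smul (c : ℂ) (f : E → ℝ → ℂ) (p : E ⊕ E) :
    G.endValue (c • f) p = c * G.endValue f p := by
  cases p <;> rfl

theorem IsContAC2.add {f g : E → ℝ → ℂ} (hf : G.IsContAC2 f) (hg : G.IsContAC2 g) :
    G.IsContAC2 (f + g) :=
  ⟨fun e => (hf.1 e).add (G.len_pos e).le (hg.1 e), fun p p' h => by
    rw [endValue_add, endValue_add, hf.2 p p' h, hg.2 p p' h]⟩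

theorem IsContAC2.smul (c : ℂ) {f : E → ℝ → ℂ} (hf : G.IsContAC2 f) : G.IsContAC2 (c • f) :=
  ⟨fun e => (hf.1 e).smul c, fun p p' h => by rw [endValue_smul, endValue_smul, hf.2 p p' h]⟩

theorem isContAC2_zero : G.IsContAC2 0 := by
  have h0 : ∀ L : ℝ, AbsolutelyContinuousOnInterval (fun _ => (0 : ℂ)) 0 L := fun L => by
    simpa using (LipschitzWith.const (0 : ℂ)).lipschitzOnWith.absolutelyContinuousOnInterval
  refine ⟨fun e => ⟨differentiableOn_const 0, h0 _, ?_⟩, fun p p' _ => by cases p <;> cases p' <;> rfl⟩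
  convert h0 (G.len e) using 1
  funext x
  simp [edgeDeriv]

/-- The graph of the Schroedinger operator, as a linear subspace of `L² × L²`. -/
def schrodingerGraph [Fintype E] (q : E → ℝ → ℝ) (α : V → ℝ) : Submodule ℂ (G.L2 × G.L2) where
  carrier := {p | G.InSchrodingerGraph q α p.1 p.2}
  zero_mem' := by
    refine ⟨0, G.isContAC2_zero, fun v => ?_, fun e => ?_, fun e => ?_⟩
    · have h1 : G.normalDeriv 0 v = 0 := by
        simpa using G.normalDeriv_smul (0 : ℂ) 0 v
      have h2 : G.vertexValue 0 v = 0 := by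
        simpa [vertexValue] using G.endValue_smul (0 : ℂ) 0 (Function.surjInv G.exists_endpoint v)
      simp [h1, h2]
    · exact Lp.coeFn_zero _ _ _
    · filter_upwards [Lp.coeFn_zero ℂ 2 (volume.restrict (Icc 0 (G.len e)))] with x hx
      have h1 : edgeDeriv (G.len e) ((0 : E → ℝ → ℂ) e) = fun _ => 0 := by
        funext y
        simpa using congrFun (edgeDeriv_smul (L := G.len e) (0 : ℂ) 0) y
      rw [h1]
      refine (hasDerivAt_const x (0 : ℂ)).congr_deriv ?_
      have hx' : ((0 : G.L2 × G.L2).2 e : ℝ → ℂ) x = 0 := hx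
      rw [hx']
      simp
  add_mem' := by
    rintro ⟨u, w⟩ ⟨u', w'⟩ ⟨f, hf, hv, hu, hw⟩ ⟨g, hg, hv', hu', hw'⟩
    refine ⟨f + g, hf.add G hg, fun v => ?_, fun e => ?_, fun e => ?_⟩
    · have h := congrArg₂ (· + ·) (hv v) (hv' v)
      simp only [add_zero] at h
      rw [G.normalDeriv_add hf hg, vertexValue, endValue_add, ← h]
      simp only [vertexValue]
      ring
    · exact (Lp.coeFn_add (u e) (u' e)).trans ((hu e).add (hu' e))
    · exact ((hw e).add (hf.1 e) (hg.1 e) (hw' e)).congr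
        (Lp.coeFn_add (w e) (w' e))
  smul_mem' := by
    rintro c ⟨u, w⟩ ⟨f, hf, hv, hu, hw⟩
    refine ⟨c • f, hf.smul G c, fun v => ?_, fun e => ?_, fun e => ?_⟩
    · have h := congrArg (c * ·) (hv v)
      simp only [mul_zero] at h
      rw [G.normalDeriv_smul, vertexValue, endValue_smul, ← h]
      simp only [vertexValue]
      ring
    · exact (Lp.coeFn_smul c (u e)).trans ((hu e).const_smul c)
    · exact ((hw e).smul c).congr (Lp.coeFn_smul c (w e))

theorem schrodingerGraph_functional [Fintype E] (q : E → ℝ → ℝ) (α : V → ℝ) (p : G.L2 × G.L2)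
    (hp : p ∈ G.schrodingerGraph q α) (h0 : p.1 = 0) : p.2 = 0 := by
  obtain ⟨f, hf, -, hu, hw⟩ := hp
  ext e : 1
  refine Lp.ext (((hw e).eq_zero (G.len_pos e) (hf.1 e) ?_).trans (Lp.coeFn_zero _ _ _).symm)
  refine (hu e).symm.trans ?_
  rw [h0]
  exact Lp.coeFn_zero _ _ _

/-- The Schroedinger operator `A_α` in `L²(G)`, an unbounded operator whose graph is
`schrodingerGraph`. -/
noncomputable def schrodingerOp [Fintype E] (q : E → ℝ → ℝ) (α : V → ℝ) :
    G.L2 →ₗ.[ℂ] G.L2 :=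
  (G.schrodingerGraph q α).toLinearPMap

theorem graph_schrodingerOp [Fintype E] (q : E → ℝ → ℝ) (α : V → ℝ) :
    (G.schrodingerOp q α).graph = G.schrodingerGraph q α :=
  Submodule.toLinearPMap_graph_eq _ (G.schrodingerGraph_functional q α)

end MetricGraph

/-! ### Eigenvalues and resolvent set of an unbounded operator -/

namespace LinearPMap

variable {H : Type*} [NormedAddCommGroup H] [NormedSpace ℂ H]

/-- `ker (A - μ)`, as a subspace of the domain of `A`. -/
def kerSub (A : H →ₗ.[ℂ] H) (μ : ℂ) : Submodule ℂ A.domain :=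
  LinearMap.ker (A.toFun - μ • A.domain.subtype)

/-- `μ` is an eigenvalue of `A`. -/
def IsEigenvalue (A : H →ₗ.[ℂ] H) (μ : ℂ) : Prop := A.kerSub μ ≠ ⊥

/-- The complement of the spectrum: the set of `μ` for which `A - μ` is a bijection from the domain
of `A` onto `H` with a bounded inverse `R`. -/
def resolventSet (A : H →ₗ.[ℂ] H) : Set ℂ :=
  {μ | ∃ R : H →L[ℂ] H, (∀ x : H, ∃ y : A.domain, (y : H) = R x ∧ A y - μ • (y : H) = x) ∧
    ∀ y : A.domain, R (A y - μ • (y : H)) = y}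

end LinearPMap

namespace MetricGraph

variable {V E : Type*} (G : MetricGraph V E)

/-! ### Titchmarsh--Weyl function, resonances -/

open Classical in
/-- `f` in `AC²` is continuous on the graph, satisfies `-f_e'' + q_e f_e = μ f_e` on every edge,
`∂_ν f (l) - α_l f (l) = 1` and `∂_ν f (v) - α_v f (v) = 0` for all vertices `v ≠ l`. -/
def IsWeylSolution [Fintype E] (q : E → ℝ → ℝ) (α : V → ℝ) (μ : ℂ) (l : V) (f : E → ℝ → ℂ) :
    Prop :=
  G.IsContAC2 f ∧ (∀ e, SchrodingerEq (G.len e) (q e) (f e) (fun x => μ * f e x)) ∧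
    ∀ v, G.normalDeriv f v - (α v : ℂ) * G.vertexValue f v = if v = l then 1 else 0

open Classical in
/-- The Titchmarsh--Weyl function `M_{B, α}`: for `μ` outside the spectrum of `A_α`, the entry
`(k, l)` of `M_{B, α} (μ)` is `f^(l) (k)` for the Weyl solution `f^(l)` (which exists and is unique for
such `μ`). Outside of its domain, the resolvent set of `A_α`, it is given the value `0`. -/
noncomputable def titchmarshWeyl [Fintype E] (q : E → ℝ → ℝ) (α : V → ℝ) (B : Finset V) (μ : ℂ) :
    Matrix B B ℂ :=
  Matrix.of fun k l =>
    if h : μ ∈ (G.schrodingerOp q α).resolventSet ∧ ∃ f, G.IsWeylSolution q α μ l f then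
      G.vertexValue (Classical.choose h.2) k
    else 0

/-- `lam` is an eigenvalue of `-d²/dx² + q_e` in `L²(0, len e)` with Dirichlet boundary conditions. -/
def IsDirichletEigenvalue (q : E → ℝ → ℝ) (e : E) (lam : ℝ) : Prop :=
  ∃ g : ℝ → ℂ, IsAC2 (G.len e) g ∧ g 0 = 0 ∧ g (G.len e) = 0 ∧
    SchrodingerEq (G.len e) (q e) g (fun x => (lam : ℂ) * g x) ∧ ∃ x ∈ Icc 0 (G.len e), g x ≠ 0

/-- `lam` is a resonance: a Dirichlet eigenvalue of each edge of some cycle. -/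
def IsResonance (q : E → ℝ → ℝ) (lam : ℝ) : Prop :=
  ∃ (n : ℕ) (v : Fin (n + 1) → V) (e : Fin (n + 1) → E),
    G.IsCycle n v e ∧ ∀ i, G.IsDirichletEigenvalue q (e i) lam

end MetricGraph

/-! ### Poles and residues of matrix functions -/

/-- `F` is analytic in a punctured neighbourhood of `z₀`. -/
def AnalyticNearPunctured {m : Type*} (F : ℂ → Matrix m m ℂ) (z₀ : ℂ) : Prop :=
  ∀ᶠ z in 𝓝[≠] z₀, ∀ k l, AnalyticAt ℂ (fun w => F w k l) z

/-- `z₀` is a pole (of some order `n ≥ 1`) of the matrix function `F`. -/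
def IsMatrixPole {m : Type*} (F : ℂ → Matrix m m ℂ) (z₀ : ℂ) : Prop :=
  AnalyticNearPunctured F z₀ ∧ ∃ n : ℕ, 1 ≤ n ∧ ∃ R : Matrix m m ℂ, R ≠ 0 ∧
    Tendsto (fun z => (z - z₀) ^ n • F z) (𝓝[≠] z₀) (𝓝 R)

/-- `R` is the residue of the matrix function `F` at `z₀`: `z₀` is an isolated singularity (possibly
removable) and `R = (2πi)⁻¹ ∮ F (z) dz` over all sufficiently small circles around `z₀`. -/
def HasMatrixResidue {m : Type*} (F : ℂ → Matrix m m ℂ) (z₀ : ℂ) (R : Matrix m m ℂ) : Prop :=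
  AnalyticNearPunctured F z₀ ∧ ∀ᶠ r in 𝓝[>] (0 : ℝ), ∀ k l,
    CircleIntegrable (fun z => F z k l) z₀ r ∧
      R k l = (2 * Real.pi * Complex.I)⁻¹ * ∮ z in C(z₀, r), F z k l

/-!
Write `K` for the kernel of `A_α - lam` and `Γ` for the graph of `A_α`. The proof shows that near `lam`
the Titchmarsh-Weyl function is `F (z) + (z - lam)⁻¹ C` with `F` analytic and `C = -Φ Φᴴ`, where the
columns of `Φ` are the values on `B` of an orthonormal basis of `K`
(`MetricGraph.exists_laurent_titchmarshWeyl`). Both assertions follow as soon as `Φ` is injective,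
since then the residue `C` has rank `dim K`.

The resolvent near `lam` is obtained without any analytic dependence of solutions on the spectral
parameter. On each edge the initial value problem with an integrable coefficient is uniquely solvable,
by a contraction in a weighted supremum norm (`exists_volterra_solution`), so the matching conditions
at the vertices become a square linear system for the initial data. Together with the symmetry of
`A_α`, which is Green's identity (`MetricGraph.inner_green`), this gives the Fredholm alternative at
`lam` (`MetricGraph.eigenspace_fredholm`). The inverse of `A_α - lam` on the orthogonal complement of `K`
is then symmetric and everywhere defined, hence a bounded operator `S` (`exists_reducedResolvent`),
and `(A_α - z)⁻¹ = (lam - z)⁻¹ P + S (1 - (z - lam) S)⁻¹` for `z ≠ lam` near `lam`, where `P` is the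
orthogonal projection onto `K` (`resolventOf_spec`).

For such `z` Weyl solutions exist by the same square system. Green's identity, applied to two Weyl
solutions, one of them at a fixed real point `ν` near `lam`, expresses the Titchmarsh-Weyl function
through the resolvent and the Weyl solutions at `ν`; applied to a Weyl solution and an
eigenfunction, it identifies the entries of `Φ` as values at vertices.

Injectivity of `Φ` is unique continuation (`MetricGraph.eqOn_zero_of_vertexValue_eq_zero`). If an
eigenfunction vanishes on `B`, the edges on which it is not identically zero form a subgraph without
vertices of degree one: at a vertex with just one such edge the function vanishes, and the
vertex condition makes its derivative vanish as well. So this subgraph is part of the core, all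
vertices at which the function does not vanish are proper core vertices, and there are none. Hence the
function solves the Dirichlet problem on each edge of the subgraph; being without vertices of degree
one, the subgraph would contain a cycle, and `lam` would be a resonance.
-/

/-! ### Absolutely continuous complex functions -/

theorem intervalIntegrable_of_integrableOn_Icc {L : ℝ} {h : ℝ → ℂ}
    (hh : IntegrableOn h (Icc 0 L)) {x : ℝ} (hx : x ∈ Icc 0 L) :
    IntervalIntegrable h volume 0 x := by
  rw [intervalIntegrable_iff_integrableOn_Icc_of_le hx.1]
  exact hh.mono_set (Icc_subset_Icc_right hx.2)

theorem absolutelyContinuousOnInterval_integral {L : ℝ} {h : ℝ → ℂ}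
    (hh : IntervalIntegrable h volume 0 L) :
    AbsolutelyContinuousOnInterval (fun x => ∫ t in 0..x, h t) 0 L := by
  have hre : IntervalIntegrable (fun t => (h t).re) volume 0 L := ⟨hh.1.re, hh.2.re⟩
  have him : IntervalIntegrable (fun t => (h t).im) volume 0 L := ⟨hh.1.im, hh.2.im⟩
  have hconst : ∀ c : ℂ, AbsolutelyContinuousOnInterval (fun _ => c) 0 L := fun c =>
    (LipschitzWith.const c).lipschitzOnWith.absolutelyContinuousOnInterval
  have h1 := (hre.absolutelyContinuousOnInterval_intervalIntegral left_mem_uIcc).fun_smul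
    (hconst 1)
  have h2 := (him.absolutelyContinuousOnInterval_intervalIntegral left_mem_uIcc).fun_smul
    (hconst Complex.I)
  have h3 := h1.fun_add h2
  have hsub : ∀ x ∈ uIcc 0 L, IntervalIntegrable h volume 0 x := fun x hx =>
    hh.mono_set (uIcc_subset_uIcc_left hx)
  have heq : ∀ x ∈ uIcc 0 L, (∫ t in 0..x, h t) = (∫ t in 0..x, (h t).re) • (1 : ℂ) +
      (∫ t in 0..x, (h t).im) • Complex.I := by
    intro x hx
    rw [← intervalIntegral.integral_smul_const, ← intervalIntegral.integral_smul_const,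
      ← intervalIntegral.integral_add]
    · congr 1
      funext t
      simp [Complex.re_add_im]
    · have := hsub x hx
      exact ⟨this.1.re.smul_const _, this.2.re.smul_const _⟩
    · have := hsub x hx
      exact ⟨this.1.im.smul_const _, this.2.im.smul_const _⟩
  rw [absolutelyContinuousOnInterval_iff] at h3 ⊢
  intro ε hε
  obtain ⟨δ, hδ, H⟩ := h3 ε hε
  refine ⟨δ, hδ, fun I hI hlen => ?_⟩
  refine lt_of_eq_of_lt (Finset.sum_congr rfl fun i hi => ?_) (H I hI hlen)
  have hm := hI.1 i hi
  rw [heq _ hm.1, heq _ hm.2]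

/-- The fundamental theorem of calculus for an absolutely continuous complex function. -/
theorem AbsolutelyContinuousOnInterval.eq_add_integral {L : ℝ} (hL : 0 ≤ L) {F h : ℝ → ℂ}
    (hF : AbsolutelyContinuousOnInterval F 0 L) (hh : IntegrableOn h (Icc 0 L))
    (hd : ∀ᵐ x ∂(volume.restrict (Icc 0 L)), HasDerivAt F (h x) x) :
    ∀ x ∈ Icc 0 L, F x = F 0 + ∫ t in 0..x, h t := by
  have hI := intervalIntegrable_of_integrableOn_Icc hh (right_mem_Icc.2 hL)
  have hac := hF.sub (absolutelyContinuousOnInterval_integral hI)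
  obtain ⟨C, hC⟩ := hac.const_of_ae_hasDerivAt_zero (by
    filter_upwards [hI.ae_hasDerivAt_integral, (ae_restrict_iff' measurableSet_Icc).1 hd]
      with x h1 h2 hx
    simpa using (h2 (by rwa [uIcc_of_le hL] at hx)).sub (h1 hx 0 left_mem_uIcc))
  rw [uIcc_of_le hL] at hC
  intro x hx
  have h0 := hC 0 (left_mem_Icc.2 hL)
  have h1 := hC x hx
  simp only [Pi.sub_apply, intervalIntegral.integral_same, sub_zero] at h0 h1
  rw [h0, ← h1]
  ring

/-! ### The linear second order equation on one interval -/

/-- The primitive `x ↦ ∫₀ˣ ‖Q‖` of the modulus of the coefficient. -/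
noncomputable def coeffMass (Q : ℝ → ℂ) (x : ℝ) : ℝ := ∫ t in 0..x, ‖Q t‖

/-- The weight `exp (2 L ∫₀ˣ ‖Q‖)`. In the supremum norm with this weight, the Volterra operator
`g ↦ ∫₀ˣ ∫₀ˢ Q g` is a contraction. -/
noncomputable def volterraWeight (L : ℝ) (Q : ℝ → ℂ) (x : ℝ) : ℝ :=
  Real.exp (2 * L * coeffMass Q x)

section Volterra

variable {L : ℝ} {Q : ℝ → ℂ}

theorem continuous_coeffMass (hQ : Integrable Q) : Continuous (coeffMass Q) :=
  intervalIntegral.continuous_primitive (fun _ _ => hQ.norm.intervalIntegrable) 0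

theorem monotone_coeffMass (hQ : Integrable Q) : Monotone (coeffMass Q) := by
  intro x y hxy
  have h := intervalIntegral.integral_interval_sub_left (a := 0) (b := y) (c := x) (f := fun t => ‖Q t‖)
    hQ.norm.intervalIntegrable hQ.norm.intervalIntegrable
  have h2 : 0 ≤ ∫ t in x..y, ‖Q t‖ :=
    intervalIntegral.integral_nonneg hxy fun _ _ => norm_nonneg _
  simp only [coeffMass]
  linarith

theorem continuous_volterraWeight (hQ : Integrable Q) : Continuous (volterraWeight L Q) :=
  Real.continuous_exp.comp ((continuous_coeffMass hQ).const_mul (2 * L))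

theorem monotone_volterraWeight (hL : 0 ≤ L) (hQ : Integrable Q) :
    Monotone (volterraWeight L Q) := fun _ _ hxy =>
  Real.exp_le_exp.2 (mul_le_mul_of_nonneg_left (monotone_coeffMass hQ hxy) (by positivity))

theorem volterraWeight_pos (x : ℝ) : 0 < volterraWeight L Q x := Real.exp_pos _

/-- The integrand is, up to the factor `2 L`, almost everywhere the derivative of the weight, and the
integral of the derivative of a monotone function is at most its increment. -/
theorem integral_norm_mul_volterraWeight_le (hL : 0 < L) (hQ : Integrable Q) {x : ℝ}
    (hx : 0 ≤ x) :
    ∫ t in 0..x, ‖Q t‖ * volterraWeight L Q t ≤ volterraWeight L Q x / (2 * L) := by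
  have hmono := (monotone_volterraWeight hL.le hQ).monotoneOn (uIcc 0 x)
  have h1 := hmono.intervalIntegral_deriv_mem_uIcc
  have hW : volterraWeight L Q 0 ≤ volterraWeight L Q x := monotone_volterraWeight hL.le hQ hx
  rw [uIcc_of_le (by linarith)] at h1
  have h2 : ∫ t in 0..x, deriv (volterraWeight L Q) t =
      ∫ t in 0..x, 2 * L * (‖Q t‖ * volterraWeight L Q t) := by
    apply intervalIntegral.integral_congr_ae
    filter_upwards [LocallyIntegrable.ae_hasDerivAt_integral hQ.norm.locallyIntegrable] with t ht _
    have h3 := ((ht 0).const_mul (2 * L)).exp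
    exact h3.deriv.trans (by simp only [volterraWeight, coeffMass]; ring)
  rw [h2, intervalIntegral.integral_const_mul] at h1
  rw [le_div_iff₀ (by positivity), mul_comm]
  linarith [h1.2, volterraWeight_pos (L := L) (Q := Q) 0]

/-- The contraction estimate: `g ↦ ∫₀ˣ ∫₀ˢ Q g` halves the weighted supremum norm. -/
theorem norm_volterra_le (hL : 0 < L) (hQ : Integrable Q) {g : ℝ → ℂ} {M : ℝ}
    (hM : 0 ≤ M) (hg : ∀ t ∈ Icc 0 L, ‖g t‖ ≤ M * volterraWeight L Q t) {x : ℝ}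
    (hx : x ∈ Icc 0 L) :
    ‖∫ s in 0..x, ∫ t in 0..s, Q t * g t‖ ≤ M * volterraWeight L Q x / 2 := by
  have hint : ∀ a b : ℝ, IntervalIntegrable (fun t => ‖Q t‖ * volterraWeight L Q t) volume a b :=
    fun a b => hQ.norm.intervalIntegrable.mul_continuousOn (continuous_volterraWeight hQ).continuousOn
  have inner : ∀ s ∈ uIoc 0 x, ‖∫ t in 0..s, Q t * g t‖ ≤
      M * (volterraWeight L Q x / (2 * L)) := by
    intro s hs
    rw [uIoc_of_le hx.1] at hs
    calc ‖∫ t in 0..s, Q t * g t‖ ≤ ∫ t in 0..s, M * (‖Q t‖ * volterraWeight L Q t) := by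
          apply intervalIntegral.norm_integral_le_of_norm_le hs.1.le
          · refine ae_of_all _ fun t ht => ?_
            rw [norm_mul]
            have := hg t ⟨ht.1.le, ht.2.trans (hs.2.trans hx.2)⟩
            nlinarith [norm_nonneg (Q t)]
          · exact (hint 0 s).const_mul M
      _ = M * ∫ t in 0..s, ‖Q t‖ * volterraWeight L Q t := intervalIntegral.integral_const_mul _ _
      _ ≤ M * (volterraWeight L Q x / (2 * L)) := by
          refine mul_le_mul_of_nonneg_left ?_ hM
          refine (integral_norm_mul_volterraWeight_le hL hQ hs.1.le).trans ?_
          gcongr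
          exact monotone_volterraWeight hL.le hQ hs.2
  refine (intervalIntegral.norm_integral_le_of_norm_le_const inner).trans ?_
  rw [sub_zero, abs_of_nonneg hx.1]
  have hW := volterraWeight_pos (L := L) (Q := Q) x
  calc M * (volterraWeight L Q x / (2 * L)) * x ≤ M * (volterraWeight L Q x / (2 * L)) * L := by
        gcongr
        exact hx.2
    _ = M * volterraWeight L Q x / 2 := by field_simp

/-- A continuous solution of the homogeneous Volterra equation vanishes. -/
theorem eqOn_zero_of_volterra (hL : 0 < L) (hQ : Integrable Q) {g : ℝ → ℂ}
    (hg : ContinuousOn g (Icc 0 L))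
    (heq : ∀ x ∈ Icc 0 L, g x = ∫ s in 0..x, ∫ t in 0..s, Q t * g t) : EqOn g 0 (Icc 0 L) := by
  obtain ⟨x₀, hx₀, hmax⟩ := isCompact_Icc.exists_isMaxOn (nonempty_Icc.2 hL.le)
    (hg.norm.div (continuous_volterraWeight (L := L) hQ).continuousOn
      fun x _ => (volterraWeight_pos x).ne')
  set M := ‖g x₀‖ / volterraWeight L Q x₀ with hMdef
  have hM : 0 ≤ M := div_nonneg (norm_nonneg _) (volterraWeight_pos _).le
  have hb : ∀ t ∈ Icc 0 L, ‖g t‖ ≤ M * volterraWeight L Q t := fun t ht =>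
    (div_le_iff₀ (volterraWeight_pos t)).1 (hmax ht)
  have h1 := norm_volterra_le hL hQ hM hb hx₀
  rw [← heq x₀ hx₀] at h1
  have h2 : ‖g x₀‖ = M * volterraWeight L Q x₀ := by
    rw [hMdef, div_mul_cancel₀ _ (volterraWeight_pos _).ne']
  have hM0 : M = 0 := by nlinarith [volterraWeight_pos (L := L) (Q := Q) x₀]
  intro t ht
  have := hb t ht
  rw [hM0, zero_mul] at this
  exact norm_le_zero_iff.1 this

/-- Existence of a solution of an inhomogeneous Volterra equation. -/
theorem exists_volterra_solution (hL : 0 < L) (hQ : Integrable Q) {c : ℝ → ℂ}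
    (hc : Continuous c) : ∃ g : ℝ → ℂ, Continuous g ∧
      ∀ x ∈ Icc 0 L, g x = c x + ∫ s in 0..x, ∫ t in 0..s, Q t * g t := by
  have hWc := continuous_volterraWeight (L := L) hQ
  have hW := volterraWeight_pos (L := L) (Q := Q)
  have hext : ∀ u : C(Icc 0 L, ℂ), Continuous fun t : ℝ =>
      (volterraWeight L Q t : ℂ) * u (projIcc 0 L hL.le t) := fun u =>
    (Complex.continuous_ofReal.comp hWc).mul (u.continuous.comp continuous_projIcc)
  have hin : ∀ u : C(Icc 0 L, ℂ), ∀ a b : ℝ, IntervalIntegrable (fun t => Q t *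
      ((volterraWeight L Q t : ℂ) * u (projIcc 0 L hL.le t))) volume a b := fun u a b =>
    hQ.intervalIntegrable.mul_continuousOn (hext u).continuousOn
  have hcont : ∀ u : C(Icc 0 L, ℂ), Continuous fun s : ℝ =>
      ∫ t in 0..s, Q t * ((volterraWeight L Q t : ℂ) * u (projIcc 0 L hL.le t)) := fun u =>
    intervalIntegral.continuous_primitive (hin u) 0
  have hcont2 : ∀ u : C(Icc 0 L, ℂ), Continuous fun x : ℝ => ∫ s in 0..x,
      ∫ t in 0..s, Q t * ((volterraWeight L Q t : ℂ) * u (projIcc 0 L hL.le t)) := fun u =>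
    intervalIntegral.continuous_primitive (fun a b => (hcont u).intervalIntegrable a b) 0
  -- The Volterra operator, conjugated by the weight, on continuous functions on `[0, L]`.
  let T : C(Icc 0 L, ℂ) → C(Icc 0 L, ℂ) := fun u =>
    ⟨fun x => (volterraWeight L Q x : ℂ)⁻¹ * (c x + ∫ s in 0..(x : ℝ), ∫ t in 0..s,
        Q t * ((volterraWeight L Q t : ℂ) * u (projIcc 0 L hL.le t))), by
      refine Continuous.mul (Continuous.inv₀ ?_ fun x => ?_) (Continuous.add ?_ ?_)
      · exact (Complex.continuous_ofReal.comp hWc).comp continuous_subtype_val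
      · exact Complex.ofReal_ne_zero.2 (hW x).ne'
      · exact hc.comp continuous_subtype_val
      · exact (hcont2 u).comp continuous_subtype_val⟩
  have hT : ContractingWith (1 / 2) T := by
    refine ⟨by norm_num, LipschitzWith.of_dist_le_mul fun u v => ?_⟩
    rw [ContinuousMap.dist_le (by positivity)]
    intro x
    have hdiff : T u x - T v x = (volterraWeight L Q x : ℂ)⁻¹ * ∫ s in 0..(x : ℝ), ∫ t in 0..s,
        Q t * ((volterraWeight L Q t : ℂ) * (u - v) (projIcc 0 L hL.le t)) := by
      simp only [T, ContinuousMap.coe_mk, ← mul_sub, add_sub_add_left_eq_sub]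
      rw [← intervalIntegral.integral_sub ((hcont u).intervalIntegrable _ _)
        ((hcont v).intervalIntegrable _ _)]
      congr 2
      funext s
      rw [← intervalIntegral.integral_sub (hin u _ _) (hin v _ _)]
      congr 1
      funext t
      rw [ContinuousMap.sub_apply]
      ring
    rw [dist_eq_norm, hdiff, norm_mul, norm_inv, Complex.norm_real,
      Real.norm_of_nonneg (hW x).le, inv_mul_le_iff₀ (hW x)]
    refine (norm_volterra_le hL hQ (M := dist u v) dist_nonneg (fun t _ => ?_) x.2).trans_eq ?_
    · rw [norm_mul, Complex.norm_real, Real.norm_of_nonneg (hW t).le, mul_comm]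
      refine mul_le_mul_of_nonneg_right ?_ (hW t).le
      rw [dist_eq_norm]
      exact (u - v).norm_coe_le_norm _
    · push_cast
      ring
  have hfix : T (hT.fixedPoint T) = hT.fixedPoint T := hT.fixedPoint_isFixedPt
  set u := hT.fixedPoint T
  refine ⟨_, hext u, fun x hx => ?_⟩
  have h1 : T u ⟨x, hx⟩ = u ⟨x, hx⟩ := by rw [hfix]
  rw [projIcc_of_mem hL.le hx, ← h1]
  simp only [T, ContinuousMap.coe_mk]
  rw [mul_inv_cancel_left₀ (Complex.ofReal_ne_zero.2 (hW x).ne')]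

end Volterra

theorem edgeDeriv_eq_of_hasDerivAt {L : ℝ} (hL : 0 < L) {f : ℝ → ℂ} {f' : ℂ} {x : ℝ}
    (hx : x ∈ Icc 0 L) (h : HasDerivAt f f' x) : edgeDeriv L f x = f' :=
  h.hasDerivWithinAt.derivWithin (uniqueDiffOn_Icc hL x hx)

theorem edgeDeriv_eqOn {L : ℝ} {f g : ℝ → ℂ} (h : EqOn f g (Icc 0 L)) :
    EqOn (edgeDeriv L f) (edgeDeriv L g) (Icc 0 L) := fun _ hx =>
  derivWithin_congr h (h hx)

theorem IsAC2.hasDerivAt {L : ℝ} {f : ℝ → ℂ} (hf : IsAC2 L f) {x : ℝ} (hx : x ∈ Ioo 0 L) :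
    HasDerivAt f (edgeDeriv L f x) x :=
  (hf.1 x (Ioo_subset_Icc_self hx)).hasDerivWithinAt.hasDerivAt (Icc_mem_nhds hx.1 hx.2)

theorem IsAC2.continuousOn_edgeDeriv {L : ℝ} (hL : 0 ≤ L) {f : ℝ → ℂ} (hf : IsAC2 L f) :
    ContinuousOn (edgeDeriv L f) (Icc 0 L) := by
  simpa [uIcc_of_le hL] using hf.3.continuousOn

theorem IsAC2.eq_add_integral {L : ℝ} (hL : 0 ≤ L) {f : ℝ → ℂ} (hf : IsAC2 L f) :
    ∀ x ∈ Icc 0 L, f x = f 0 + ∫ t in 0..x, edgeDeriv L f t :=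
  hf.2.eq_add_integral hL ((hf.continuousOn_edgeDeriv hL).integrableOn_Icc) (by
    filter_upwards [ae_mem_Ioo L] with x hx
    exact hf.hasDerivAt hx)

/-- Existence for the initial value problem `f'' = Q f - w`, `f 0 = a`, `f' 0 = b`. -/
theorem exists_isAC2_of_integrable {L : ℝ} (hL : 0 < L) {Q w : ℝ → ℂ}
    (hQ : IntegrableOn Q (Icc 0 L)) (hw : IntegrableOn w (Icc 0 L)) (a b : ℂ) :
    ∃ f : ℝ → ℂ, IsAC2 L f ∧ f 0 = a ∧ edgeDeriv L f 0 = b ∧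
      ∀ᵐ x ∂(volume.restrict (Icc 0 L)), HasDerivAt (edgeDeriv L f) (Q x * f x - w x) x := by
  -- Extend the coefficients by zero.
  have hQ' : Integrable ((Icc 0 L).indicator Q) := (integrable_indicator_iff measurableSet_Icc).2 hQ
  have hw' : Integrable ((Icc 0 L).indicator w) := (integrable_indicator_iff measurableSet_Icc).2 hw
  set Q' := (Icc 0 L).indicator Q with hQdef
  set w' := (Icc 0 L).indicator w with hwdef
  have hcw : Continuous fun s : ℝ => b - ∫ t in 0..s, w' t :=
    continuous_const.sub (intervalIntegral.continuous_primitive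
      (fun _ _ => hw'.intervalIntegrable) 0)
  obtain ⟨g, hg, hgeq⟩ := exists_volterra_solution hL hQ'
    (c := fun x => a + ∫ s in 0..x, (b - ∫ t in 0..s, w' t))
    (continuous_const.add (intervalIntegral.continuous_primitive
      (fun _ _ => hcw.intervalIntegrable _ _) 0))
  have hQg : ∀ x y : ℝ, IntervalIntegrable (fun t => Q' t * g t) volume x y := fun x y =>
    hQ'.intervalIntegrable.mul_continuousOn hg.continuousOn
  have hh : ∀ x y : ℝ, IntervalIntegrable (fun t => Q' t * g t - w' t) volume x y := fun x y =>
    (hQg x y).sub hw'.intervalIntegrable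
  set p : ℝ → ℂ := fun s => b + ∫ t in 0..s, (Q' t * g t - w' t) with hp
  have hpc : Continuous p := continuous_const.add (intervalIntegral.continuous_primitive hh 0)
  set f : ℝ → ℂ := fun x => a + ∫ s in 0..x, p s with hf
  have hfg : EqOn f g (Icc 0 L) := by
    intro x hx
    rw [hgeq x hx, hf]
    simp only [add_assoc]
    rw [← intervalIntegral.integral_add (hcw.intervalIntegrable _ _)
      ((intervalIntegral.continuous_primitive hQg 0).intervalIntegrable _ _)]
    congr 2
    funext s
    rw [hp]
    simp only
    rw [intervalIntegral.integral_sub (hQg 0 s) hw'.intervalIntegrable]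
    ring
  have hder : ∀ x, HasDerivAt f (p x) x := fun x =>
    (intervalIntegral.integral_hasDerivAt_right (hpc.intervalIntegrable 0 x)
      (hpc.stronglyMeasurableAtFilter _ _) hpc.continuousAt).const_add a
  have hed : EqOn (edgeDeriv L f) p (Icc 0 L) := fun x hx =>
    edgeDeriv_eq_of_hasDerivAt hL hx (hder x)
  have hconst : ∀ c : ℂ, AbsolutelyContinuousOnInterval (fun _ => c) 0 L := fun c =>
    (LipschitzWith.const c).lipschitzOnWith.absolutelyContinuousOnInterval
  have hacp : AbsolutelyContinuousOnInterval p 0 L :=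
    (hconst b).fun_add (absolutelyContinuousOnInterval_integral (hh 0 L))
  refine ⟨f, ⟨fun x _ => (hder x).differentiableAt.differentiableWithinAt,
    (hconst a).fun_add (absolutelyContinuousOnInterval_integral (hpc.intervalIntegrable 0 L)),
    hacp.congr_Icc hL.le hed⟩, by simp [hf], ?_, ?_⟩
  · rw [hed (left_mem_Icc.2 hL.le)]
    simp [hp]
  · have h1 := (hh 0 L).ae_hasDerivAt_integral
    filter_upwards [ae_restrict_of_ae h1, ae_mem_Ioo L] with x hx hxm
    have hxI := Ioo_subset_Icc_self hxm
    have h2 := (hx (by rwa [uIcc_of_le hL.le]) 0 left_mem_uIcc).const_add b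
    have h3 : edgeDeriv L f =ᶠ[𝓝 x] p := hed.eventuallyEq_of_mem (Icc_mem_nhds hxm.1 hxm.2)
    refine (h2.congr_of_eventuallyEq h3).congr_deriv ?_
    rw [hfg hxI, hQdef, hwdef, indicator_of_mem hxI, indicator_of_mem hxI]

/-- Uniqueness for the initial value problem. -/
theorem eqOn_zero_of_initial_zero {L : ℝ} (hL : 0 < L) {Q f : ℝ → ℂ}
    (hQ : IntegrableOn Q (Icc 0 L)) (hf : IsAC2 L f) (h0 : f 0 = 0) (h0' : edgeDeriv L f 0 = 0)
    (h : ∀ᵐ x ∂(volume.restrict (Icc 0 L)), HasDerivAt (edgeDeriv L f) (Q x * f x) x) :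
    EqOn f 0 (Icc 0 L) := by
  have hQ' : Integrable ((Icc 0 L).indicator Q) := (integrable_indicator_iff measurableSet_Icc).2 hQ
  refine eqOn_zero_of_volterra hL hQ' hf.1.continuousOn fun x hx => ?_
  have hQf : IntegrableOn (fun t => Q t * f t) (Icc 0 L) :=
    hQ.mul_continuousOn hf.1.continuousOn isCompact_Icc
  rw [hf.eq_add_integral hL.le x hx, h0, zero_add]
  refine intervalIntegral.integral_congr fun s hs => ?_
  rw [uIcc_of_le hx.1] at hs
  have hs' : s ∈ Icc 0 L := ⟨hs.1, hs.2.trans hx.2⟩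
  rw [hf.3.eq_add_integral hL.le hQf h s hs', h0', zero_add]
  refine intervalIntegral.integral_congr fun t ht => ?_
  rw [uIcc_of_le hs.1] at ht
  rw [indicator_of_mem (show t ∈ Icc 0 L from ⟨ht.1, ht.2.trans hs'.2⟩)]

/-- Green's identity on one interval: `∫ (f g'' - f'' g) = [f g' - f' g]`. -/
theorem IsAC2.green {L : ℝ} (hL : 0 < L) {f g F H : ℝ → ℂ} (hf : IsAC2 L f) (hg : IsAC2 L g)
    (hF : IntegrableOn F (Icc 0 L)) (hH : IntegrableOn H (Icc 0 L))
    (hdf : ∀ᵐ x ∂(volume.restrict (Icc 0 L)), HasDerivAt (edgeDeriv L f) (F x) x)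
    (hdg : ∀ᵐ x ∂(volume.restrict (Icc 0 L)), HasDerivAt (edgeDeriv L g) (H x) x) :
    ∫ x in Icc 0 L, (f x * H x - F x * g x) =
      (f L * edgeDeriv L g L - edgeDeriv L f L * g L) -
        (f 0 * edgeDeriv L g 0 - edgeDeriv L f 0 * g 0) := by
  have hint : IntegrableOn (fun x => f x * H x - F x * g x) (Icc 0 L) :=
    (hH.continuousOn_mul hf.1.continuousOn isCompact_Icc).sub
      (hF.mul_continuousOn hg.1.continuousOn isCompact_Icc)
  have hac := (hf.2.fun_smul hg.3).fun_sub (hf.3.fun_smul hg.2)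
  have h1 := hac.eq_add_integral hL.le hint (by
    filter_upwards [hdf, hdg, ae_mem_Ioo L] with x h1 h2 hx
    refine (((hf.hasDerivAt hx).mul h2).sub (h1.mul (hg.hasDerivAt hx))).congr_deriv ?_
    ring) L (right_mem_Icc.2 hL.le)
  rw [intervalIntegral.integral_of_le hL.le, ← integral_Icc_eq_integral_Ioc] at h1
  simp only [smul_eq_mul] at h1
  rw [h1]
  ring

/-- Uniqueness for the initial value problem at the right endpoint: the Wronskians with the two
fundamental solutions are constant. -/
theorem eqOn_zero_of_terminal_zero {L : ℝ} (hL : 0 < L) {Q f : ℝ → ℂ}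
    (hQ : IntegrableOn Q (Icc 0 L)) (hf : IsAC2 L f) (h0 : f L = 0) (h0' : edgeDeriv L f L = 0)
    (h : ∀ᵐ x ∂(volume.restrict (Icc 0 L)), HasDerivAt (edgeDeriv L f) (Q x * f x) x) :
    EqOn f 0 (Icc 0 L) := by
  have key : ∀ a b : ℂ, f 0 * b - edgeDeriv L f 0 * a = 0 := by
    intro a b
    obtain ⟨g, hg, rfl, rfl, hgd⟩ := exists_isAC2_of_integrable hL hQ
      (w := fun _ => 0) integrableOn_zero a b
    have hQf : ∀ {k : ℝ → ℂ}, IsAC2 L k → IntegrableOn (fun t => Q t * k t) (Icc 0 L) :=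
      fun hk => hQ.mul_continuousOn hk.1.continuousOn isCompact_Icc
    have h1 := hf.green hL hg (hQf hf) (hQf hg) h (by simpa using hgd)
    have h2 : ∀ x, f x * (Q x * g x) - Q x * f x * g x = 0 := fun x => by ring
    simp only [h2, integral_zero, h0, h0', zero_mul, zero_sub, sub_zero] at h1
    linear_combination h1
  exact eqOn_zero_of_initial_zero hL hQ hf (by simpa using key 0 1) (by simpa using key 1 0) h

/-! ### Cycles in subgraphs without vertices of degree one -/

namespace MetricGraph

variable {V E : Type*} (G : MetricGraph V E)

/-- A nonempty subgraph without vertices of degree one contains a cycle: a walk in it can be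
continued forever without backtracking, and a shortest closed piece of such a walk is a cycle. -/
theorem exists_isCycle_of_noDegreeOne [Finite V] [Finite E] {S : Set E} (hS : G.NoDegreeOne S)
    (hne : S.Nonempty) : ∃ (n : ℕ) (v : Fin (n + 1) → V) (e : Fin (n + 1) → E),
      G.IsCycle n v e ∧ ∀ i, e i ∈ S := by
  have hnext : ∀ p : {p : E ⊕ E // Sum.elim id id p ∈ S}, ∃ p' : {p : E ⊕ E // Sum.elim id id p ∈ S},
      G.vertexOf p'.1 = G.vertexOf p.1.swap ∧ p'.1 ≠ p.1.swap := by
    rintro ⟨p, hp⟩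
    by_contra! hcon
    refine hS (G.vertexOf p.swap) (Set.ncard_eq_one.2 ⟨p.swap, Set.eq_singleton_iff_unique_mem.2
      ⟨⟨rfl, ?_⟩, fun p' hp' => hcon ⟨p', hp'.2⟩ hp'.1⟩⟩)
    cases p <;> exact hp
  choose next hnext1 hnext2 using hnext
  obtain ⟨e₀, he₀⟩ := hne
  let p : ℕ → {p : E ⊕ E // Sum.elim id id p ∈ S} := fun k => next^[k] ⟨Sum.inl e₀, he₀⟩
  have hp : ∀ k, p (k + 1) = next (p k) := fun k => Function.iterate_succ_apply' _ _ _
  let v : ℕ → V := fun k => G.vertexOf (p k).1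
  have hv : ∀ k, G.vertexOf (p k).1.swap = v (k + 1) := fun k => by
    simp only [v, hp, hnext1]
  have hback : ∀ k, (p (k + 1)).1 ≠ (p k).1.swap := fun k => by
    rw [hp]
    exact hnext2 _
  have hex : ∃ d, 0 < d ∧ ∃ i, v i = v (i + d) := by
    obtain ⟨i, j, hij, h⟩ := Finite.exists_ne_map_eq_of_infinite v
    rcases lt_or_gt_of_ne hij with hlt | hlt
    · exact ⟨j - i, by omega, i, by rw [h]; congr 1; omega⟩
    · exact ⟨i - j, by omega, j, by rw [← h]; congr 1; omega⟩
  classical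
  obtain ⟨hd0, i, hi⟩ := Nat.find_spec hex
  have hmin : ∀ m < Nat.find hex, 0 < m → ∀ i, v i ≠ v (i + m) := fun m hm h0 i hi =>
    Nat.find_min hex hm ⟨h0, i, hi⟩
  obtain ⟨n, hn⟩ : ∃ n, Nat.find hex = n + 1 := ⟨Nat.find hex - 1, by omega⟩
  rw [hn] at hi hmin
  have hne : ∀ a b : ℕ, a < b → b < n + 1 → v (i + a) ≠ v (i + b) := fun a b hab hb h =>
    hmin (b - a) (by omega) (by omega) (i + a) (by rw [h]; congr 1; omega)
  have hedge : ∀ a b : ℕ, a < b → b < n + 1 →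
      Sum.elim id id (p (i + a)).1 ≠ Sum.elim id id (p (i + b)).1 := by
    intro a b hab hb h
    have hcase : (p (i + b)).1 = (p (i + a)).1 ∨ (p (i + b)).1 = (p (i + a)).1.swap := by
      revert h
      cases (p (i + a)).1 <;> cases (p (i + b)).1 <;> simp +contextual
    rcases hcase with h1 | h1
    · exact hne a b hab hb (by simp only [v, h1])
    · have h2 : v (i + (a + 1)) = v (i + b) := by
        rw [← add_assoc, ← hv, ← h1]
      rcases Nat.lt_or_ge (a + 1) b with h3 | h3
      · exact hne (a + 1) b h3 hb h2
      · obtain rfl : b = a + 1 := by omega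
        exact hback (i + a) h1
  refine ⟨n, fun k => v (i + k), fun k => Sum.elim id id (p (i + k)).1, ⟨?_, ?_, ?_⟩,
    fun k => (p (i + k)).2⟩
  · intro a b h
    by_contra hab
    rcases lt_or_gt_of_ne hab with hlt | hlt
    · exact hne a b hlt b.2 h
    · exact hne b a hlt a.2 h.symm
  · intro a b h
    by_contra hab
    rcases lt_or_gt_of_ne hab with hlt | hlt
    · exact hedge a b hlt b.2 h
    · exact hedge b a hlt a.2 h.symm
  · intro k
    have h1 : v (i + k + 1) = v (i + (k + 1 : Fin (n + 1))) := by
      rw [Fin.val_add_one]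
      split_ifs with hk
      · rw [hk, add_zero, Fin.val_last, add_assoc, ← hi]
      · rw [add_assoc]
    have h2 := hv (i + k)
    simp only [← h1, ← h2]
    have h3 : v (i + k) = G.vertexOf (p (i + k)).1 := rfl
    rw [h3]
    rcases (p (i + k)).1 with e | e
    · exact Or.inl ⟨rfl, rfl⟩
    · exact Or.inr ⟨rfl, rfl⟩

end MetricGraph

/-! ### The reduced resolvent of a symmetric operator -/

section Abstract

variable {H : Type*} [NormedAddCommGroup H] [InnerProductSpace ℂ H]

/-- Let `Γ` be the graph of a symmetric operator `A`, and let `lam` be real. If the kernel `K` of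
`A - lam` is finite-dimensional and spans the whole space together with the range of `A - lam`, then
`A - lam` has a bounded inverse on the orthogonal complement of `K`, extended here by zero to `K`. It is
everywhere defined and symmetric, and hence bounded by the Hellinger-Toeplitz theorem. -/
theorem exists_reducedResolvent [CompleteSpace H] (Γ : Submodule ℂ (H × H))
    (hsymm : ∀ x ∈ Γ, ∀ y ∈ Γ, inner ℂ x.2 y.1 = inner ℂ x.1 y.2) (lam : ℝ)
    (K : Submodule ℂ H) [FiniteDimensional ℂ K] (hK : ∀ u, u ∈ K ↔ (u, (lam : ℂ) • u) ∈ Γ)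
    (hF : ∀ w, ∃ φ ∈ K, ∃ u, (u, w - φ + (lam : ℂ) • u) ∈ Γ) :
    ∃ S : H →L[ℂ] H, (∀ x, (S x, x - K.starProjection x + (lam : ℂ) • S x) ∈ Γ) ∧
      (∀ x, K.starProjection (S x) = 0) ∧
      ∀ u x, (u, x + (lam : ℂ) • u) ∈ Γ → K.starProjection u = 0 → S x = u := by
  set P := K.starProjection with hP
  have hPK : ∀ x, P x ∈ K := fun x => K.starProjection_apply_mem x
  have hPid : ∀ x ∈ K, P x = x := fun x hx => K.starProjection_eq_self_iff.2 hx
  have hPorth : ∀ u, P u = 0 ↔ u ∈ Kᗮ := fun u => K.starProjection_apply_eq_zero_iff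
  have hran : ∀ u x, (u, x + (lam : ℂ) • u) ∈ Γ → P x = 0 := by
    intro u x hx
    rw [hPorth, Submodule.mem_orthogonal]
    intro k hk
    have h := hsymm _ ((hK k).1 hk) _ hx
    simp only [inner_smul_left, inner_add_right, inner_smul_right, Complex.conj_ofReal] at h
    linear_combination -h
  have huniq : ∀ u u' x, (u, x + (lam : ℂ) • u) ∈ Γ → (u', x + (lam : ℂ) • u') ∈ Γ → P u = 0 →
      P u' = 0 → u = u' := by
    intro u u' x hu hu' h h'
    have h1 : u - u' ∈ K := by
      rw [hK]
      convert Γ.sub_mem hu hu' using 1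
      rw [Prod.mk_sub_mk, smul_sub, add_sub_add_left_eq_sub]
    have h2 := hPid _ h1
    rw [map_sub, h, h', sub_zero] at h2
    exact sub_eq_zero.1 h2.symm
  have hex : ∀ x, ∃ u, (u, x - P x + (lam : ℂ) • u) ∈ Γ ∧ P u = 0 := by
    intro x
    obtain ⟨φ, hφ, u, hu⟩ := hF x
    have h1 : P x = φ := by
      have := hran u (x - φ) hu
      rwa [map_sub, hPid φ hφ, sub_eq_zero] at this
    refine ⟨u - P u, ?_, by rw [map_sub, hPid _ (hPK u), sub_self]⟩
    convert Γ.sub_mem hu ((hK _).1 (hPK u)) using 1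
    rw [Prod.mk_sub_mk, smul_sub, h1]
    congr 1
    abel
  choose s hs1 hs2 using hex
  let S₀ : H →ₗ[ℂ] H :=
    { toFun := s
      map_add' := fun x y => by
        refine huniq _ _ (x + y - P (x + y)) (hs1 _) ?_ (hs2 _) (by rw [map_add, hs2, hs2, add_zero])
        convert Γ.add_mem (hs1 x) (hs1 y) using 1
        rw [Prod.mk_add_mk, map_add, smul_add]
        congr 1
        abel
      map_smul' := fun c x => by
        refine huniq _ _ (c • x - P (c • x)) (hs1 _) ?_ (hs2 _)
          (by simp only [RingHom.id_apply, map_smul, hs2, smul_zero])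
        convert Γ.smul_mem c (hs1 x) using 1
        simp only [RingHom.id_apply, Prod.smul_mk, map_smul, smul_add, smul_sub, smul_comm c] }
  have hS₀ : S₀.IsSymmetric := by
    have hdrop : ∀ x y, inner ℂ (s x) (P y) = 0 := fun x y =>
      Submodule.inner_left_of_mem_orthogonal (hPK y) ((hPorth _).1 (hs2 x))
    have hdrop' : ∀ x y, inner ℂ (P y) (s x) = 0 := fun x y =>
      Submodule.inner_right_of_mem_orthogonal (hPK y) ((hPorth _).1 (hs2 x))
    intro x y
    have h := hsymm _ (hs1 x) _ (hs1 y)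
    simp only [inner_add_left, inner_add_right, inner_sub_left, inner_sub_right, inner_smul_left,
      inner_smul_right, Complex.conj_ofReal, hdrop, hdrop'] at h
    change inner ℂ (s x) y = inner ℂ x (s y)
    linear_combination -h
  refine ⟨⟨S₀, hS₀.continuous⟩, hs1, hs2, fun u x hux hu => ?_⟩
  refine huniq _ _ _ (hs1 x) ?_ (hs2 x) hu
  rwa [hran u x hux, sub_zero]

/-- The resolvent at `mu` in terms of the spectral projection `P` at `lam` and the reduced resolvent
`S` at `lam`. It is meaningful where `mu ≠ lam` and `1 - (mu - lam) • S` is invertible; elsewhere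
the inverses take the value zero. -/
noncomputable def resolventOf (P S : H →L[ℂ] H) (lam mu : ℂ) : H →L[ℂ] H :=
  (lam - mu)⁻¹ • P + S * Ring.inverse (1 - (mu - lam) • S)

/-- Near `lam`, except at `lam` itself, the operator `resolventOf P S lam mu` is the inverse of
`A - mu`. -/
theorem resolventOf_spec (Γ : Submodule ℂ (H × H))
    (hsymm : ∀ x ∈ Γ, ∀ y ∈ Γ, inner ℂ x.2 y.1 = inner ℂ x.1 y.2) (lam : ℝ)
    (K : Submodule ℂ H) [FiniteDimensional ℂ K] (hK : ∀ u, u ∈ K ↔ (u, (lam : ℂ) • u) ∈ Γ)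
    (S : H →L[ℂ] H) (hS1 : ∀ x, (S x, x - K.starProjection x + (lam : ℂ) • S x) ∈ Γ)
    (hS2 : ∀ x, K.starProjection (S x) = 0)
    (hS3 : ∀ u x, (u, x + (lam : ℂ) • u) ∈ Γ → K.starProjection u = 0 → S x = u)
    {mu : ℂ} (hmu : mu ≠ lam) (hunit : IsUnit (1 - (mu - lam) • S)) :
    (∀ x, (resolventOf K.starProjection S lam mu x,
      x + mu • resolventOf K.starProjection S lam mu x) ∈ Γ) ∧
    ∀ u x, (u, x + mu • u) ∈ Γ → resolventOf K.starProjection S lam mu x = u := by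
  set P := K.starProjection with hP
  set N := Ring.inverse (1 - (mu - lam) • S) with hN
  set R := resolventOf P S lam mu with hR
  have hne : (lam : ℂ) - mu ≠ 0 := sub_ne_zero.2 hmu.symm
  have hRx : ∀ x, R x = ((lam : ℂ) - mu)⁻¹ • P x + S (N x) := fun x => rfl
  have hfst : ∀ x, (R x, x + mu • R x) ∈ Γ := by
    intro x
    have hNx : N x - (mu - (lam : ℂ)) • S (N x) = x := by
      have := congrArg (fun T : H →L[ℂ] H => T x) (Ring.mul_inverse_cancel _ hunit)
      simpa using this
    have hPN : P (N x) = P x := by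
      have := congrArg P hNx
      rwa [map_sub, map_smul, hS2, smul_zero, sub_zero] at this
    have h1 := (hK _).1 (Submodule.smul_mem K ((lam : ℂ) - mu)⁻¹ (K.starProjection_apply_mem x))
    convert Γ.add_mem h1 (hS1 (N x)) using 1
    rw [Prod.mk_add_mk, hRx]
    congr 1
    rw [← hP, hPN]
    have h3 : N x = x + (mu - (lam : ℂ)) • S (N x) := sub_eq_iff_eq_add.1 hNx
    have h4 : P x = ((lam : ℂ) - mu) • ((lam : ℂ) - mu)⁻¹ • P x := by
      rw [smul_smul, mul_inv_cancel₀ hne, one_smul]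
    set y := ((lam : ℂ) - mu)⁻¹ • P x
    rw [h4]
    set z := S (N x)
    rw [h3]
    module
  refine ⟨hfst, fun u x hu => ?_⟩
  -- The difference `d` of two solutions is an eigenvector for `mu`, hence orthogonal to `K`, and
  -- therefore fixed by `(mu - lam) • S`.
  set d := R x - u with hd
  have hdΓ : (d, mu • d) ∈ Γ := by
    convert Γ.sub_mem (hfst x) hu using 1
    rw [Prod.mk_sub_mk, add_sub_add_left_eq_sub, smul_sub]
  have hPd : P d = 0 := by
    rw [hP, K.starProjection_apply_eq_zero_iff, Submodule.mem_orthogonal]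
    intro k hk
    have h := hsymm _ ((hK k).1 hk) _ hdΓ
    simp only [inner_smul_left, inner_smul_right, Complex.conj_ofReal] at h
    have h2 : ((lam : ℂ) - mu) * inner ℂ k d = 0 := by linear_combination h
    exact (mul_eq_zero.1 h2).resolve_left hne
  have hSd : S ((mu - (lam : ℂ)) • d) = d := by
    refine hS3 _ _ ?_ hPd
    convert hdΓ using 2
    rw [← add_smul, sub_add_cancel]
  have h0 : (1 - (mu - (lam : ℂ)) • S) d = 0 := by
    rw [map_smul] at hSd
    simp [hSd]
  have h1 := congrArg (fun T : H →L[ℂ] H => T d) (Ring.inverse_mul_cancel _ hunit)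
  have h2 : Ring.inverse (1 - (mu - (lam : ℂ)) • S) ((1 - (mu - (lam : ℂ)) • S) d) = d := h1
  rw [h0, map_zero] at h2
  exact sub_eq_zero.1 h2.symm

end Abstract

/-! ### The Schroedinger equation on one edge -/

open scoped ComplexConjugate

section Edge

variable {L : ℝ} {q : ℝ → ℝ}

theorem integrableOn_ofReal_sub (hq : IntegrableOn q (Icc 0 L)) (μ : ℂ) :
    IntegrableOn (fun x => (q x : ℂ) - μ) (Icc 0 L) :=
  Integrable.sub hq.ofReal (integrableOn_const (by simp))

theorem IsAC2.memLp {f : ℝ → ℂ} (hf : IsAC2 L f) :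
    MemLp f 2 (volume.restrict (Icc 0 L)) := by
  obtain ⟨C, hC⟩ := isCompact_Icc.exists_bound_of_continuousOn hf.1.continuousOn
  refine MemLp.of_bound (hf.1.continuousOn.aestronglyMeasurable measurableSet_Icc) C ?_
  exact (ae_restrict_iff' measurableSet_Icc).2 (ae_of_all _ hC)

theorem edgeDeriv_conj (f : ℝ → ℂ) :
    edgeDeriv L (fun x => conj (f x)) = fun x => conj (edgeDeriv L f x) := by
  funext x
  exact derivWithin.star

theorem IsAC2.conj {f : ℝ → ℂ} (hf : IsAC2 L f) : IsAC2 L (fun x => conj (f x)) := by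
  have hac : ∀ {g : ℝ → ℂ}, AbsolutelyContinuousOnInterval g 0 L →
      AbsolutelyContinuousOnInterval (fun x => conj (g x)) 0 L := by
    intro g hg
    rw [absolutelyContinuousOnInterval_iff] at hg ⊢
    simpa only [Complex.dist_conj_conj] using hg
  refine ⟨fun x hx => (hf.1 x hx).star, hac hf.2, ?_⟩
  rw [edgeDeriv_conj]
  exact hac hf.3

theorem SchrodingerEq.conj {f w : ℝ → ℂ} (h : SchrodingerEq L q f w) :
    SchrodingerEq L q (fun x => conj (f x)) (fun x => conj (w x)) := by
  filter_upwards [h] with x hx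
  rw [edgeDeriv_conj]
  refine hx.star.congr_deriv ?_
  simp

/-- Green's identity for the Schroedinger expression on one edge. -/
theorem SchrodingerEq.green (hL : 0 < L) (hq : IntegrableOn q (Icc 0 L)) {f g w z : ℝ → ℂ}
    (hf : IsAC2 L f) (hg : IsAC2 L g) (hw : IntegrableOn w (Icc 0 L))
    (hz : IntegrableOn z (Icc 0 L)) (h : SchrodingerEq L q f w) (h' : SchrodingerEq L q g z) :
    ∫ x in Icc 0 L, (w x * g x - f x * z x) =
      (f L * edgeDeriv L g L - edgeDeriv L f L * g L) -
        (f 0 * edgeDeriv L g 0 - edgeDeriv L f 0 * g 0) := by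
  have hqf : ∀ {k : ℝ → ℂ}, IsAC2 L k → IntegrableOn (fun t => (q t : ℂ) * k t) (Icc 0 L) :=
    fun hk => IntegrableOn.mul_continuousOn (μ := volume) hq.ofReal hk.1.continuousOn isCompact_Icc
  rw [← hf.green hL hg ((hqf hf).sub hw) ((hqf hg).sub hz) h h']
  congr 1
  funext x
  simp only [Pi.sub_apply]
  ring

theorem exists_edgeSolution (hL : 0 < L) (hq : IntegrableOn q (Icc 0 L)) (μ : ℂ) {w : ℝ → ℂ}
    (hw : IntegrableOn w (Icc 0 L)) (a b : ℂ) :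
    ∃ f : ℝ → ℂ, IsAC2 L f ∧ f 0 = a ∧ edgeDeriv L f 0 = b ∧
      SchrodingerEq L q f (fun x => μ * f x + w x) := by
  obtain ⟨f, hf, h0, h1, h2⟩ :=
    exists_isAC2_of_integrable hL (integrableOn_ofReal_sub hq μ) hw a b
  refine ⟨f, hf, h0, h1, ?_⟩
  filter_upwards [h2] with x hx
  exact hx.congr_deriv (by ring)

theorem SchrodingerEq.eqOn_zero_of_left (hL : 0 < L) (hq : IntegrableOn q (Icc 0 L)) {μ : ℂ}
    {f : ℝ → ℂ} (hf : IsAC2 L f) (h : SchrodingerEq L q f (fun x => μ * f x)) (h0 : f 0 = 0)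
    (h1 : edgeDeriv L f 0 = 0) : EqOn f 0 (Icc 0 L) := by
  refine eqOn_zero_of_initial_zero hL (integrableOn_ofReal_sub hq μ) hf h0 h1 ?_
  filter_upwards [h] with x hx
  exact hx.congr_deriv (by ring)

theorem SchrodingerEq.eqOn_zero_of_right (hL : 0 < L) (hq : IntegrableOn q (Icc 0 L)) {μ : ℂ}
    {f : ℝ → ℂ} (hf : IsAC2 L f) (h : SchrodingerEq L q f (fun x => μ * f x)) (h0 : f L = 0)
    (h1 : edgeDeriv L f L = 0) : EqOn f 0 (Icc 0 L) := by
  refine eqOn_zero_of_terminal_zero hL (integrableOn_ofReal_sub hq μ) hf h0 h1 ?_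
  filter_upwards [h] with x hx
  exact hx.congr_deriv (by ring)

end Edge

namespace MetricGraph

variable {V E : Type*} (G : MetricGraph V E)

/-! ### Values at the vertices -/

/-- The edge endpoint at which `vertexValue` reads off the value at `v`. -/
noncomputable def refEnd (v : V) : E ⊕ E := Function.surjInv G.exists_endpoint v

theorem vertexOf_refEnd (v : V) : G.vertexOf (G.refEnd v) = v :=
  Function.surjInv_eq G.exists_endpoint v

theorem endValue_eq_vertexValue {f : E → ℝ → ℂ} (hf : G.ContinuousAtVertices f) (p : E ⊕ E) :
    G.endValue f p = G.vertexValue f (G.vertexOf p) :=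
  hf _ _ (G.vertexOf_refEnd _).symm

variable {G} in
theorem vertexValue_congr {f g : E → ℝ → ℂ} (h : ∀ e, EqOn (f e) (g e) (Icc 0 (G.len e))) (v : V) :
    G.vertexValue f v = G.vertexValue g v := by
  rw [vertexValue, vertexValue]
  rcases Function.surjInv G.exists_endpoint v with e | e
  · exact h e (left_mem_Icc.2 (G.len_pos e).le)
  · exact h e (right_mem_Icc.2 (G.len_pos e).le)

variable {G}

theorem vertexValue_conj (f : E → ℝ → ℂ) (v : V) :
    G.vertexValue (fun e x => conj (f e x)) v = conj (G.vertexValue f v) := by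
  rw [vertexValue, vertexValue]
  rcases Function.surjInv G.exists_endpoint v with e | e <;> rfl

theorem ContinuousAtVertices.conj {f : E → ℝ → ℂ} (hf : G.ContinuousAtVertices f) :
    G.ContinuousAtVertices (fun e x => conj (f e x)) := by
  have key : ∀ p, G.endValue (fun e x => conj (f e x)) p = conj (G.endValue f p) := by
    rintro (e | e) <;> rfl
  intro p p' h
  rw [key, key, hf p p' h]

/-! ### Classes in `L²` -/

/-- `u` is the class in `L²` of the function `f` on the graph. -/
def Represents (u : G.L2) (f : E → ℝ → ℂ) : Prop :=
  ∀ e, u e =ᵐ[volume.restrict (Icc 0 (G.len e))] f e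

theorem Represents.eq {u u' : G.L2} {f : E → ℝ → ℂ} (h : Represents u f) (h' : Represents u' f) :
    u = u' := by
  ext e : 1
  exact Lp.ext ((h e).trans (h' e).symm)

theorem Represents.add {u u' : G.L2} {f f' : E → ℝ → ℂ} (h : Represents u f)
    (h' : Represents u' f') : Represents (u + u') (f + f') := fun e =>
  (Lp.coeFn_add (u e) (u' e)).trans ((h e).add (h' e))

theorem Represents.smul {u : G.L2} {f : E → ℝ → ℂ} (c : ℂ) (h : Represents u f) :
    Represents (c • u) (c • f) := fun e =>
  (Lp.coeFn_smul c (u e)).trans ((h e).const_smul c)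

theorem Represents.sub {u u' : G.L2} {f f' : E → ℝ → ℂ} (h : Represents u f)
    (h' : Represents u' f') : Represents (u - u') (f - f') := fun e =>
  (Lp.coeFn_sub (u e) (u' e)).trans ((h e).sub (h' e))

/-- A representative of zero that is differentiable on each edge vanishes. -/
theorem Represents.eqOn_zero {f : E → ℝ → ℂ} (hf : ∀ e, IsAC2 (G.len e) (f e))
    (h : Represents (0 : G.L2) f) (e : E) : EqOn (f e) 0 (Icc 0 (G.len e)) :=
  Measure.eqOn_Icc_of_ae_eq volume (G.len_pos e).ne
    ((h e).symm.trans (Lp.coeFn_zero ℂ 2 (volume.restrict (Icc 0 (G.len e)))))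
    (hf e).1.continuousOn continuousOn_const

variable (G) in
/-- The class in `L²` of a function that is in `AC²` on each edge. -/
noncomputable def toL2 (f : E → ℝ → ℂ) (hf : ∀ e, IsAC2 (G.len e) (f e)) : G.L2 :=
  WithLp.toLp 2 fun e => (hf e).memLp.toLp (f e)

theorem represents_toL2 {f : E → ℝ → ℂ} (hf : ∀ e, IsAC2 (G.len e) (f e)) :
    Represents (G.toL2 f hf) f := fun e => (hf e).memLp.coeFn_toLp

theorem integrableOn_coe_L2 (u : G.L2) (e : E) : IntegrableOn (u e : ℝ → ℂ) (Icc 0 (G.len e)) :=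
  (Lp.memLp (u e)).integrable (by norm_num)

variable (G)

/-! ### Boundary data at the vertices -/

variable [Fintype E]

/-- The defect `∂_ν f (v) - α_v f (v)` in the vertex condition. -/
noncomputable def robinData (α : V → ℝ) (f : E → ℝ → ℂ) (v : V) : ℂ :=
  G.normalDeriv f v - (α v : ℂ) * G.vertexValue f v

open Classical in
/-- All matching conditions at once. There are as many as edge endpoints: at the reference endpoint of
each vertex stands the defect in the vertex condition, and at any other endpoint the deviation from
the value at the reference endpoint. Hence on each edge two initial values face two conditions. -/
noncomputable def boundaryData (α : V → ℝ) (f : E → ℝ → ℂ) (p : E ⊕ E) : ℂ :=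
  if p = G.refEnd (G.vertexOf p) then G.robinData α f (G.vertexOf p)
  else G.endValue f p - G.vertexValue f (G.vertexOf p)

open Classical in
theorem boundaryData_eq_iff (α : V → ℝ) (f : E → ℝ → ℂ) (c : V → ℂ) :
    G.boundaryData α f = (fun p => if p = G.refEnd (G.vertexOf p) then c (G.vertexOf p) else 0) ↔
      G.ContinuousAtVertices f ∧ ∀ v, G.robinData α f v = c v := by
  constructor
  · intro h
    refine ⟨?_, fun v => ?_⟩
    · have key : ∀ p, G.endValue f p = G.vertexValue f (G.vertexOf p) := by
        intro p
        by_cases hp : p = G.refEnd (G.vertexOf p)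
        · conv_lhs => rw [hp]
          rfl
        · have := congrFun h p
          simp only [boundaryData, if_neg hp] at this
          exact sub_eq_zero.1 this
      intro p p' hpp
      rw [key p, key p', hpp]
    · have := congrFun h (G.refEnd v)
      simpa [boundaryData, G.vertexOf_refEnd v] using this
  · rintro ⟨h1, h2⟩
    funext p
    rw [boundaryData, h2, G.endValue_eq_vertexValue h1, sub_self]

theorem boundaryData_eq_zero_iff (α : V → ℝ) (f : E → ℝ → ℂ) :
    G.boundaryData α f = 0 ↔ G.ContinuousAtVertices f ∧ ∀ v, G.robinData α f v = 0 := by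
  classical
  rw [← G.boundaryData_eq_iff α f (fun _ => 0)]
  simp only [ite_self]
  rfl

theorem boundaryData_add (α : V → ℝ) {f g : E → ℝ → ℂ} (hf : ∀ e, IsAC2 (G.len e) (f e))
    (hg : ∀ e, IsAC2 (G.len e) (g e)) :
    G.boundaryData α (f + g) = G.boundaryData α f + G.boundaryData α g := by
  have key : ∀ e, ∀ x ∈ Icc 0 (G.len e), edgeDeriv (G.len e) ((f + g) e) x =
      edgeDeriv (G.len e) (f e) x + edgeDeriv (G.len e) (g e) x := fun e x hx =>
    edgeDeriv_add (hf e).1 (hg e).1 hx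
  have hn : ∀ v, G.normalDeriv (f + g) v = G.normalDeriv f v + G.normalDeriv g v := fun v => by
    simp only [normalDeriv, key _ _ (right_mem_Icc.2 (G.len_pos _).le),
      key _ _ (left_mem_Icc.2 (G.len_pos _).le), Finset.sum_add_distrib]
    ring
  funext p
  simp only [boundaryData, robinData, hn, vertexValue, endValue_add, Pi.add_apply]
  split_ifs <;> ring

theorem boundaryData_smul (α : V → ℝ) (c : ℂ) (f : E → ℝ → ℂ) :
    G.boundaryData α (c • f) = c • G.boundaryData α f := by
  funext p
  simp only [boundaryData, robinData, normalDeriv_smul, vertexValue, endValue_smul, Pi.smul_apply,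
    smul_eq_mul]
  split_ifs <;> ring

/-- `boundaryData` along a linear family of functions. -/
noncomputable def boundaryMap {X : Type*} [AddCommGroup X] [Module ℂ X] (α : V → ℝ)
    (U : X →ₗ[ℂ] (E → ℝ → ℂ)) (hU : ∀ x e, IsAC2 (G.len e) (U x e)) : X →ₗ[ℂ] (E ⊕ E → ℂ) where
  toFun x := G.boundaryData α (U x)
  map_add' x y := by rw [map_add, G.boundaryData_add α (hU x) (hU y)]
  map_smul' c x := by rw [map_smul, boundaryData_smul, RingHom.id_apply]

/-! ### Green's identity on the graph -/

theorem sum_boundary_eq [Fintype V] {f g : E → ℝ → ℂ} (hf : G.ContinuousAtVertices f)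
    (hg : G.ContinuousAtVertices g) :
    ∑ e, ((f e (G.len e) * edgeDeriv (G.len e) (g e) (G.len e) -
        edgeDeriv (G.len e) (f e) (G.len e) * g e (G.len e)) -
      (f e 0 * edgeDeriv (G.len e) (g e) 0 - edgeDeriv (G.len e) (f e) 0 * g e 0)) =
    ∑ v, (G.vertexValue f v * G.normalDeriv g v - G.normalDeriv f v * G.vertexValue g v) := by
  classical
  have h0 : ∀ {k : E → ℝ → ℂ}, G.ContinuousAtVertices k → ∀ e, k e 0 = G.vertexValue k (G.o e) :=
    fun hk e => G.endValue_eq_vertexValue hk (Sum.inl e)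
  have hL : ∀ {k : E → ℝ → ℂ}, G.ContinuousAtVertices k →
      ∀ e, k e (G.len e) = G.vertexValue k (G.t e) :=
    fun hk e => G.endValue_eq_vertexValue hk (Sum.inr e)
  simp only [normalDeriv, mul_sub, sub_mul, Finset.mul_sum, Finset.sum_mul,
    Finset.sum_sub_distrib, h0 hf, h0 hg, hL hf, hL hg]
  have hfib : ∀ (π : E → V) (a : V → E → ℂ), ∑ v, ∑ e with π e = v, a v e = ∑ e, a (π e) e := by
    intro π a
    rw [← Finset.sum_fiberwise Finset.univ π]
    refine Finset.sum_congr rfl fun v _ => Finset.sum_congr rfl fun e he => ?_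
    rw [(Finset.mem_filter.1 he).2]
  rw [hfib G.t (fun v e => G.vertexValue f v * edgeDeriv (G.len e) (g e) (G.len e)),
    hfib G.o (fun v e => G.vertexValue f v * edgeDeriv (G.len e) (g e) 0),
    hfib G.t (fun v e => edgeDeriv (G.len e) (f e) (G.len e) * G.vertexValue g v),
    hfib G.o (fun v e => edgeDeriv (G.len e) (f e) 0 * G.vertexValue g v)]
  ring

variable {G}

theorem robinData_conj (α : V → ℝ) (f : E → ℝ → ℂ) (v : V) :
    G.robinData α (fun e x => conj (f e x)) v = conj (G.robinData α f v) := by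
  simp only [robinData, vertexValue_conj, normalDeriv, edgeDeriv_conj, map_sub, map_mul, map_sum,
    Complex.conj_ofReal]

/-- Green's identity on the graph, in terms of the inner product of `L²`. -/
theorem inner_green [Fintype V] {q : E → ℝ → ℝ} (hq : ∀ e, IntegrableOn (q e) (Icc 0 (G.len e)))
    (α : V → ℝ) {f g : E → ℝ → ℂ} (hf : G.IsContAC2 f) (hg : G.IsContAC2 g) {u u' w w' : G.L2}
    (hu : Represents u f) (hu' : Represents u' g)
    (hw : ∀ e, SchrodingerEq (G.len e) (q e) (f e) (w e))
    (hw' : ∀ e, SchrodingerEq (G.len e) (q e) (g e) (w' e)) :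
    inner ℂ w u' - inner ℂ u w' = ∑ v, (conj (G.vertexValue f v) * G.robinData α g v -
      conj (G.robinData α f v) * G.vertexValue g v) := by
  have h1 : ∀ e, ∫ x in Icc 0 (G.len e), (conj (w e x) * g e x - conj (f e x) * w' e x) =
      inner ℂ (w e) (u' e) - inner ℂ (u e) (w' e) := by
    intro e
    rw [L2.inner_def, L2.inner_def, ← integral_sub (L2.integrable_inner _ _)
      (L2.integrable_inner _ _)]
    refine integral_congr_ae ?_
    filter_upwards [hu e, hu' e] with x h1 h2
    simp only [RCLike.inner_apply, h1, h2]
    ring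
  have hcw : ∀ e, IntegrableOn (fun x => conj (w e x)) (Icc 0 (G.len e)) := fun e =>
    Complex.conjCLE.toContinuousLinearMap.integrable_comp (integrableOn_coe_L2 w e)
  rw [PiLp.inner_apply, PiLp.inner_apply, ← Finset.sum_sub_distrib]
  simp only [← h1]
  simp only [fun e => SchrodingerEq.green (G.len_pos e) (hq e) (hf.1 e).conj (hg.1 e) (hcw e)
    (integrableOn_coe_L2 w' e) (hw e).conj (hw' e)]
  rw [G.sum_boundary_eq (f := fun e x => conj (f e x)) hf.2.conj hg.2]
  refine Finset.sum_congr rfl fun v _ => ?_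
  rw [← vertexValue_conj, ← robinData_conj, robinData, robinData]
  ring

end MetricGraph

/-! ### Solvability of the boundary value problem -/

namespace MetricGraph

variable {V E : Type*} {G : MetricGraph V E}

/-- Initial value problems can be solved linearly in the initial data and the inhomogeneity. -/
theorem exists_solutionFamily {q : E → ℝ → ℝ} (hq : ∀ e, IntegrableOn (q e) (Icc 0 (G.len e)))
    (μ : ℂ) {X : Type*} [AddCommGroup X] [Module ℂ X] (w : X →ₗ[ℂ] (E → ℝ → ℂ))
    (hw : ∀ x e, IntegrableOn (w x e) (Icc 0 (G.len e))) (ini : X →ₗ[ℂ] (E → ℂ × ℂ)) :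
    ∃ U : X →ₗ[ℂ] (E → ℝ → ℂ), (∀ x e, IsAC2 (G.len e) (U x e)) ∧
      (∀ x e, U x e 0 = (ini x e).1) ∧ (∀ x e, edgeDeriv (G.len e) (U x e) 0 = (ini x e).2) ∧
      ∀ x e, SchrodingerEq (G.len e) (q e) (U x e) (fun t => μ * U x e t + w x e t) := by
  let b := Module.Basis.ofVectorSpace ℂ X
  choose g hg h0 h1 hs using fun i e => exists_edgeSolution (G.len_pos e) (hq e) μ (hw (b i) e)
    (ini (b i) e).1 (ini (b i) e).2
  let U : X →ₗ[ℂ] (E → ℝ → ℂ) := b.constr ℂ g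
  have key : ∀ x, ∀ e, IsAC2 (G.len e) (U x e) ∧ U x e 0 = (ini x e).1 ∧
      edgeDeriv (G.len e) (U x e) 0 = (ini x e).2 ∧
      SchrodingerEq (G.len e) (q e) (U x e) (fun t => μ * U x e t + w x e t) := by
    intro x
    have hx : x ∈ Submodule.span ℂ (range b) := by
      rw [b.span_eq]
      trivial
    have hsmul : ∀ (c : ℂ) (y : X), (∀ e, IsAC2 (G.len e) (U y e) ∧ U y e 0 = (ini y e).1 ∧
        edgeDeriv (G.len e) (U y e) 0 = (ini y e).2 ∧
        SchrodingerEq (G.len e) (q e) (U y e) (fun t => μ * U y e t + w y e t)) →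
        ∀ e, IsAC2 (G.len e) (U (c • y) e) ∧ U (c • y) e 0 = (ini (c • y) e).1 ∧
        edgeDeriv (G.len e) (U (c • y) e) 0 = (ini (c • y) e).2 ∧
        SchrodingerEq (G.len e) (q e) (U (c • y) e)
          (fun t => μ * U (c • y) e t + w (c • y) e t) := by
      intro c y hy e
      obtain ⟨hy1, hy2, hy3, hy4⟩ := hy e
      simp only [map_smul, Pi.smul_apply]
      refine ⟨hy1.smul c, ?_, ?_, ?_⟩
      · rw [hy2, Prod.smul_fst]
      · rw [edgeDeriv_smul, Pi.smul_apply, hy3, Prod.smul_snd]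
      · convert hy4.smul c using 1
        funext t
        simp only [Pi.smul_apply, smul_eq_mul]
        ring
    induction hx using Submodule.span_induction with
    | mem x hx =>
      obtain ⟨i, rfl⟩ := hx
      have hU : U (b i) = g i := b.constr_basis ℂ g i
      intro e
      rw [hU]
      exact ⟨hg i e, h0 i e, h1 i e, hs i e⟩
    | zero =>
      have hd : ∀ L, edgeDeriv L (0 : ℝ → ℂ) = fun _ => 0 := fun L => by
        funext t
        simp [edgeDeriv]
      intro e
      simp only [map_zero, Pi.zero_apply, Prod.fst_zero, Prod.snd_zero, mul_zero, add_zero, hd]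
      refine ⟨G.isContAC2_zero.1 e, trivial, trivial, ae_of_all _ fun t => ?_⟩
      simpa [hd] using hasDerivAt_const t (0 : ℂ)
    | add x y _ _ hx hy =>
      intro e
      obtain ⟨hx1, hx2, hx3, hx4⟩ := hx e
      obtain ⟨hy1, hy2, hy3, hy4⟩ := hy e
      simp only [map_add, Pi.add_apply]
      refine ⟨hx1.add (G.len_pos e).le hy1, ?_, ?_, ?_⟩
      · rw [hx2, hy2, Prod.fst_add]
      · rw [edgeDeriv_add hx1.1 hy1.1 (left_mem_Icc.2 (G.len_pos e).le), Pi.add_apply, hx3, hy3,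
          Prod.snd_add]
      · convert SchrodingerEq.add hx1 hy1 hx4 hy4 using 1
        funext t
        simp only [Pi.add_apply]
        ring
    | smul c x _ hx => exact hsmul c x hx
  exact ⟨U, fun x e => (key x e).1, fun x e => (key x e).2.1, fun x e => (key x e).2.2.1,
    fun x e => (key x e).2.2.2⟩

/-- All solutions of the homogeneous equation, parametrized linearly by their initial data on the
edges. -/
theorem exists_homogeneousSolution {q : E → ℝ → ℝ}
    (hq : ∀ e, IntegrableOn (q e) (Icc 0 (G.len e))) (μ : ℂ) :
    ∃ sol : (E → ℂ × ℂ) →ₗ[ℂ] (E → ℝ → ℂ), (∀ c e, IsAC2 (G.len e) (sol c e)) ∧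
      (∀ c e, SchrodingerEq (G.len e) (q e) (sol c e) (fun t => μ * sol c e t)) ∧
      (∀ c, (∀ e, EqOn (sol c e) 0 (Icc 0 (G.len e))) → c = 0) ∧
      ∀ f : E → ℝ → ℂ, (∀ e, IsAC2 (G.len e) (f e)) →
        (∀ e, SchrodingerEq (G.len e) (q e) (f e) (fun t => μ * f e t)) →
        ∃ c, ∀ e, EqOn (f e) (sol c e) (Icc 0 (G.len e)) := by
  obtain ⟨sol, h1, h2, h3, h4⟩ := exists_solutionFamily hq μ (X := E → ℂ × ℂ) 0
    (fun x e => integrableOn_zero) LinearMap.id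
  have h4' : ∀ c e, SchrodingerEq (G.len e) (q e) (sol c e) (fun t => μ * sol c e t) := by
    intro c e
    simpa using h4 c e
  refine ⟨sol, h1, h4', fun c hc => ?_, fun f hf hs => ?_⟩
  · funext e
    have hl : (0 : ℝ) ∈ Icc 0 (G.len e) := left_mem_Icc.2 (G.len_pos e).le
    refine Prod.ext ?_ ?_
    · exact (h2 c e).symm.trans (hc e hl)
    · refine (h3 c e).symm.trans ((edgeDeriv_eqOn (hc e) hl).trans ?_)
      exact edgeDeriv_eq_of_hasDerivAt (G.len_pos e) hl (hasDerivAt_const _ _)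
  · refine ⟨fun e => (f e 0, edgeDeriv (G.len e) (f e) 0), fun e => ?_⟩
    set c : E → ℂ × ℂ := fun e => (f e 0, edgeDeriv (G.len e) (f e) 0) with hc
    have hn : IsAC2 (G.len e) ((-1 : ℂ) • sol c e) := (h1 c e).smul _
    have h := SchrodingerEq.eqOn_zero_of_left (G.len_pos e) (hq e) (μ := μ)
      ((hf e).add (G.len_pos e).le hn) ?_ ?_ ?_
    · intro x hx
      have := h hx
      simp only [Pi.add_apply, Pi.smul_apply, smul_eq_mul, Pi.zero_apply] at this
      linear_combination this
    · convert SchrodingerEq.add (hf e) hn (hs e) ((h4' c e).smul (-1)) using 1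
      funext t
      simp only [Pi.add_apply, Pi.smul_apply, smul_eq_mul]
      ring
    · simp [h2, hc]
    · rw [edgeDeriv_add (hf e).1 hn.1 (left_mem_Icc.2 (G.len_pos e).le), Pi.add_apply,
        edgeDeriv_smul, Pi.smul_apply, h3]
      simp [hc]

theorem Represents.schrodingerEq_smul {q : E → ℝ → ℝ} {u : G.L2} {f : E → ℝ → ℂ} (h : Represents u f) (μ : ℂ)
    (e : E) : SchrodingerEq (G.len e) (q e) (f e) ((μ • u) e) ↔
      SchrodingerEq (G.len e) (q e) (f e) (fun t => μ * f e t) :=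
  ⟨fun hs => hs.congr ((h.smul μ) e).symm, fun hs => hs.congr ((h.smul μ) e)⟩

variable [Fintype E] {q : E → ℝ → ℝ} {α : V → ℝ}

theorem mem_schrodingerGraph_iff {u w : G.L2} : (u, w) ∈ G.schrodingerGraph q α ↔
    ∃ f, G.IsContAC2 f ∧ (∀ v, G.robinData α f v = 0) ∧ Represents u f ∧
      ∀ e, SchrodingerEq (G.len e) (q e) (f e) (w e) := Iff.rfl

theorem mem_schrodingerGraph_smul_iff {u : G.L2} {μ : ℂ} :
    (u, μ • u) ∈ G.schrodingerGraph q α ↔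
    ∃ f, G.IsContAC2 f ∧ (∀ v, G.robinData α f v = 0) ∧ Represents u f ∧
      ∀ e, SchrodingerEq (G.len e) (q e) (f e) (fun t => μ * f e t) := by
  rw [mem_schrodingerGraph_iff]
  refine exists_congr fun f => and_congr_right fun _ => and_congr_right fun _ =>
    and_congr_right fun h => forall_congr' fun e => h.schrodingerEq_smul μ e

theorem schrodingerGraph_symm [Fintype V] (hq : ∀ e, IntegrableOn (q e) (Icc 0 (G.len e))) :
    ∀ x ∈ G.schrodingerGraph q α, ∀ y ∈ G.schrodingerGraph q α,
      inner ℂ x.2 y.1 = inner ℂ x.1 y.2 := by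
  rintro ⟨u, w⟩ ⟨f, hf, hr, hu, hw⟩ ⟨u', w'⟩ ⟨g, hg, hr', hu', hw'⟩
  have h := inner_green hq α hf hg hu hu' hw hw'
  have hr1 : ∀ v, G.robinData α f v = 0 := hr
  have hr2 : ∀ v, G.robinData α g v = 0 := hr'
  simp only [hr1, hr2, map_zero, mul_zero, zero_mul, sub_zero, Finset.sum_const_zero] at h
  exact sub_eq_zero.1 h

variable (G q α) in
/-- The kernel of `A_α - μ`, as a subspace of `L²`. -/
noncomputable def eigenspace (μ : ℂ) : Submodule ℂ G.L2 :=
  (G.schrodingerGraph q α).comap (LinearMap.id.prod (μ • LinearMap.id))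

theorem mem_eigenspace {μ : ℂ} {u : G.L2} :
    u ∈ G.eigenspace q α μ ↔ (u, μ • u) ∈ G.schrodingerGraph q α := Iff.rfl

theorem rank_kerSub (μ : ℂ) : Module.rank ℂ ((G.schrodingerOp q α).kerSub μ) =
    Module.rank ℂ (G.eigenspace q α μ) := by
  have h : ((G.schrodingerOp q α).kerSub μ).map (G.schrodingerOp q α).domain.subtype =
      G.eigenspace q α μ := by
    ext u
    rw [mem_eigenspace, ← graph_schrodingerOp, LinearPMap.mem_graph_iff]
    constructor
    · rintro ⟨y, hy, rfl⟩
      refine ⟨y, rfl, ?_⟩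
      exact sub_eq_zero.1 hy
    · rintro ⟨y, rfl, hy⟩
      exact ⟨y, sub_eq_zero.2 hy, rfl⟩
  rw [← h]
  exact ((Submodule.equivSubtypeMap _ _).rank_eq)

/-- The Fredholm alternative: the eigenspace is finite-dimensional, and it spans `L²` together with
the range of `A_α - lam`.

Whether `w` belongs to the range of `A_α - lam` is decided by the boundary data of a particular solution
modulo the range of the square matrix that takes initial data to boundary data. By symmetry, the
boundary data of solutions whose inhomogeneity is an eigenfunction meet that range only in zero, and a
count of dimensions shows that they fill a complement. -/
theorem eigenspace_fredholm [Fintype V] (hq : ∀ e, IntegrableOn (q e) (Icc 0 (G.len e)))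
    (lam : ℝ) : FiniteDimensional ℂ (G.eigenspace q α (lam : ℂ)) ∧
      ∀ w, ∃ φ ∈ G.eigenspace q α (lam : ℂ), ∃ u,
        (u, w - φ + (lam : ℂ) • u) ∈ G.schrodingerGraph q α := by
  obtain ⟨sol, hsol, heq, hinj, hsurj⟩ := exists_homogeneousSolution (G := G) hq (lam : ℂ)
  obtain ⟨U, hU, -, -, hUeq⟩ := exists_solutionFamily (G := G) hq (lam : ℂ) sol
    (fun c e => ((hsol c e).1.continuousOn).integrableOn_Icc) 0
  let Λ : (E → ℂ × ℂ) →ₗ[ℂ] G.L2 :=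
    { toFun := fun c => G.toL2 (sol c) (hsol c)
      map_add' := fun c d => (represents_toL2 _).eq (by
        rw [map_add]
        exact (represents_toL2 _).add (represents_toL2 _))
      map_smul' := fun a c => (represents_toL2 _).eq (by
        rw [map_smul]
        exact (represents_toL2 _).smul a) }
  have hΛ : ∀ c, Represents (Λ c) (sol c) := fun c => represents_toL2 (hsol c)
  have hΛinj : ∀ c, Λ c = 0 → c = 0 := fun c hc =>
    hinj c (Represents.eqOn_zero (hsol c) (hc ▸ hΛ c))
  let T := G.boundaryMap α sol hsol
  have hΛker : ∀ c ∈ LinearMap.ker T, Λ c ∈ G.eigenspace q α (lam : ℂ) := by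
    intro c hc
    obtain ⟨h1, h2⟩ := (G.boundaryData_eq_zero_iff α (sol c)).1 hc
    exact mem_schrodingerGraph_smul_iff.2 ⟨sol c, ⟨hsol c, h1⟩, h2, hΛ c, heq c⟩
  refine ⟨?_, ?_⟩
  · refine Submodule.finiteDimensional_of_le (S₂ := LinearMap.range Λ) fun u hu => ?_
    obtain ⟨f, hf, -, hr, hs⟩ := mem_schrodingerGraph_smul_iff.1 hu
    obtain ⟨c, hc⟩ := hsurj f hf.1 hs
    refine ⟨c, (hΛ c).eq fun e => (hr e).trans ?_⟩
    exact (ae_restrict_iff' measurableSet_Icc).2 (ae_of_all _ fun x hx => hc e hx)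
  · let Ψ : (E → ℂ × ℂ) × LinearMap.ker T →ₗ[ℂ] (E ⊕ E → ℂ) :=
      T.coprod ((G.boundaryMap α U hU).comp (LinearMap.ker T).subtype)
    have hAC : ∀ c d e, IsAC2 (G.len e) ((sol d + U c) e) := fun c d e =>
      (hsol d e).add (G.len_pos e).le (hU c e)
    have hS : ∀ c d e, SchrodingerEq (G.len e) (q e) ((sol d + U c) e)
        (fun t => lam * (sol d + U c) e t + sol c e t) := by
      intro c d e
      refine (SchrodingerEq.add (hsol d e) (hU c e) (heq d e) (hUeq c e)).congr
        (ae_of_all _ fun t => ?_)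
      simp only [Pi.add_apply]
      ring
    have hΨ : ∀ d c, Ψ (d, c) = G.boundaryData α (sol d + U c) := fun d c => by
      rw [G.boundaryData_add α (hsol d) (hU c)]
      rfl
    have hker : ∀ x ∈ LinearMap.ker Ψ, x.2 = 0 := by
      rintro ⟨d, c⟩ hx
      have hx' : G.boundaryData α (sol d + U c) = 0 := by
        rw [← hΨ]
        exact hx
      obtain ⟨h1, h2⟩ := (G.boundaryData_eq_zero_iff α _).1 hx'
      have hu := represents_toL2 (hAC c d)
      set u := G.toL2 (sol d + U c) (hAC c d)
      have hmem : (u, (lam : ℂ) • u + Λ c) ∈ G.schrodingerGraph q α :=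
        ⟨sol d + U c, ⟨hAC c d, h1⟩, h2, hu, fun e =>
          (hS c d e).congr (((hu.smul (lam : ℂ)).add (hΛ c)) e)⟩
      have h3 := schrodingerGraph_symm hq _ (hΛker c c.2) _ hmem
      change inner ℂ ((lam : ℂ) • Λ c) u = inner ℂ (Λ c) ((lam : ℂ) • u + Λ c) at h3
      rw [inner_smul_left, inner_add_right, inner_smul_right, Complex.conj_ofReal] at h3
      have h4 : inner ℂ (Λ c) (Λ c) = 0 := by linear_combination -h3
      exact Subtype.ext (hΛinj _ (inner_self_eq_zero.1 h4))
    have hsur : LinearMap.range Ψ = ⊤ := by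
      apply Submodule.eq_top_of_finrank_eq
      have h1 := LinearMap.finrank_range_add_finrank_ker Ψ
      have h2 : Module.finrank ℂ (LinearMap.ker Ψ) ≤ Module.finrank ℂ (LinearMap.ker T) := by
        have hT : ∀ x : LinearMap.ker Ψ, x.1.1 ∈ LinearMap.ker T := by
          rintro ⟨⟨d, c⟩, hx⟩
          have hc : c = 0 := hker _ hx
          subst hc
          have : Ψ (d, 0) = T d := by simp [Ψ]
          exact this.symm.trans hx
        refine LinearMap.finrank_le_finrank_of_injective
          (f := ((LinearMap.fst ℂ _ _).comp (LinearMap.ker Ψ).subtype).codRestrict _ hT) ?_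
        rintro ⟨⟨d, c⟩, hx⟩ ⟨⟨d', c'⟩, hx'⟩ h
        have hc : c = 0 := hker _ hx
        have hc' : c' = 0 := hker _ hx'
        subst hc hc'
        have : d = d' := congrArg Subtype.val h
        subst this
        rfl
      have h3 := LinearMap.finrank_range_le Ψ
      have h4 : Module.finrank ℂ (E → ℂ × ℂ) = Module.finrank ℂ (E ⊕ E → ℂ) := by
        simp [Module.finrank_pi_fintype]
        ring
      have h5 := Submodule.finrank_le (LinearMap.range Ψ)
      rw [Module.finrank_prod] at h1
      omega
    intro w
    choose p hp _ _ hps using fun e => exists_edgeSolution (G.len_pos e) (hq e) (lam : ℂ)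
      (integrableOn_coe_L2 w e) 0 0
    obtain ⟨⟨d, c⟩, hdc⟩ : G.boundaryData α p ∈ LinearMap.range Ψ := hsur ▸ Submodule.mem_top
    rw [hΨ] at hdc
    have hAC' : ∀ e, IsAC2 (G.len e) (((-1 : ℂ) • (sol d + U c)) e) := fun e => (hAC c d e).smul _
    have hf : ∀ e, IsAC2 (G.len e) ((p + (-1 : ℂ) • (sol d + U c)) e) := fun e =>
      (hp e).add (G.len_pos e).le (hAC' e)
    have hb : G.boundaryData α (p + (-1 : ℂ) • (sol d + U c)) = 0 := by
      rw [G.boundaryData_add α hp hAC', boundaryData_smul, hdc, neg_one_smul, add_neg_cancel]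
    obtain ⟨h1, h2⟩ := (G.boundaryData_eq_zero_iff α _).1 hb
    have hu := represents_toL2 hf
    refine ⟨Λ c, hΛker c c.2, _, _, ⟨hf, h1⟩, h2, hu, fun e => ?_⟩
    have hs := SchrodingerEq.add (hp e) (hAC' e) (hps e) ((hS c d e).smul (-1))
    refine hs.congr ?_
    have hw : Represents w (fun e => (w e : ℝ → ℂ)) := fun e => EventuallyEq.rfl
    refine (((hw.sub (hΛ c)).add (hu.smul (lam : ℂ))) e).trans (ae_of_all _ fun t => ?_)
    simp only [Pi.add_apply, Pi.sub_apply, Pi.smul_apply, smul_eq_mul]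
    ring

/-! ### Weyl solutions -/

/-- Where `A_α - μ` is injective, the square system for the initial data is uniquely solvable. -/
theorem exists_isWeylSolution (hq : ∀ e, IntegrableOn (q e) (Icc 0 (G.len e))) {μ : ℂ}
    (hμ : ∀ u, (u, μ • u) ∈ G.schrodingerGraph q α → u = 0) (l : V) :
    ∃ f, G.IsWeylSolution q α μ l f := by
  classical
  obtain ⟨sol, hsol, heq, hinj, -⟩ := exists_homogeneousSolution (G := G) hq μ
  let T := G.boundaryMap α sol hsol
  have hT : Function.Injective T := by
    rw [injective_iff_map_eq_zero]
    intro c hc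
    obtain ⟨h1, h2⟩ := (G.boundaryData_eq_zero_iff α (sol c)).1 hc
    have hu := represents_toL2 (hsol c)
    have h0 := hμ _ (mem_schrodingerGraph_smul_iff.2 ⟨sol c, ⟨hsol c, h1⟩, h2, hu, heq c⟩)
    rw [h0] at hu
    exact hinj c (Represents.eqOn_zero (hsol c) hu)
  have hdim : Module.finrank ℂ (E → ℂ × ℂ) = Module.finrank ℂ (E ⊕ E → ℂ) := by
    simp [Module.finrank_pi_fintype]
    ring
  obtain ⟨c, hc⟩ := (LinearMap.injective_iff_surjective_of_finrank_eq_finrank hdim).1 hT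
    (fun p => if p = G.refEnd (G.vertexOf p) then (if G.vertexOf p = l then 1 else 0) else 0)
  obtain ⟨h1, h2⟩ := (G.boundaryData_eq_iff α (sol c) (fun v => if v = l then 1 else 0)).1 hc
  refine ⟨sol c, ⟨hsol c, h1⟩, heq c, fun v => ?_⟩
  exact h2 v

theorem mem_resolventSet {μ : ℂ} {R : G.L2 →L[ℂ] G.L2}
    (h1 : ∀ x, (R x, x + μ • R x) ∈ G.schrodingerGraph q α)
    (h2 : ∀ u x, (u, x + μ • u) ∈ G.schrodingerGraph q α → R x = u) :
    μ ∈ (G.schrodingerOp q α).resolventSet := by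
  refine ⟨R, fun x => ?_, fun y => ?_⟩
  · have h := h1 x
    rw [← graph_schrodingerOp, LinearPMap.mem_graph_iff] at h
    obtain ⟨y, hy1, hy2⟩ := h
    refine ⟨y, hy1, ?_⟩
    rw [hy2, hy1, add_sub_cancel_right]
  · refine h2 _ _ ?_
    rw [sub_add_cancel, ← graph_schrodingerOp]
    exact LinearPMap.mem_graph _ y

/-- The difference of two functions with equal defects in the vertex conditions lies in the domain
of `A_α`. -/
theorem sub_mem_schrodingerGraph {f g : E → ℝ → ℂ} (hf : G.IsContAC2 f) (hg : G.IsContAC2 g)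
    (hfg : ∀ v, G.robinData α f v = G.robinData α g v) {u u' w w' : G.L2} (hu : Represents u f)
    (hu' : Represents u' g) (hw : ∀ e, SchrodingerEq (G.len e) (q e) (f e) (w e))
    (hw' : ∀ e, SchrodingerEq (G.len e) (q e) (g e) (w' e)) :
    (u - u', w - w') ∈ G.schrodingerGraph q α := by
  have hn := hg.smul G (-1)
  refine ⟨f + (-1 : ℂ) • g, hf.add G hn, fun v => ?_, ?_, fun e => ?_⟩
  · have := hfg v
    simp only [robinData] at this
    rw [G.normalDeriv_add hf hn, normalDeriv_smul, vertexValue, endValue_add, endValue_smul]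
    simp only [vertexValue] at this
    linear_combination this
  · have h : f + (-1 : ℂ) • g = f - g := by rw [neg_one_smul, sub_eq_add_neg]
    rw [h]
    exact hu.sub hu'
  · refine ((hw e).add (hf.1 e) (hn.1 e) ((hw' e).smul (-1))).congr ?_
    refine (Lp.coeFn_sub (w e) (w' e)).trans (ae_of_all _ fun t => ?_)
    simp [sub_eq_add_neg]

open Classical in
theorem IsWeylSolution.robinData {μ : ℂ} {l : V} {f : E → ℝ → ℂ}
    (hf : G.IsWeylSolution q α μ l f) (v : V) :
    G.robinData α f v = if v = l then 1 else 0 := hf.2.2 v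

theorem titchmarshWeyl_apply {μ : ℂ} (hμ : μ ∈ (G.schrodingerOp q α).resolventSet)
    (hinj : ∀ u, (u, μ • u) ∈ G.schrodingerGraph q α → u = 0) {B : Finset V} (k l : B)
    {f : E → ℝ → ℂ} (hf : G.IsWeylSolution q α μ l f) :
    G.titchmarshWeyl q α B μ k l = G.vertexValue f k := by
  have h : μ ∈ (G.schrodingerOp q α).resolventSet ∧ ∃ f, G.IsWeylSolution q α μ l f := ⟨hμ, f, hf⟩
  rw [titchmarshWeyl, Matrix.of_apply, dif_pos h]
  set g := Classical.choose h.2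
  have hg : G.IsWeylSolution q α μ l g := Classical.choose_spec h.2
  have hu := represents_toL2 hf.1.1
  have hu' := represents_toL2 hg.1.1
  have h1 := sub_mem_schrodingerGraph hg.1 hf.1
    (fun v => (hg.robinData v).trans (hf.robinData v).symm) hu' hu
    (fun e => (hu'.schrodingerEq_smul μ e).2 (hg.2.1 e))
    (fun e => (hu.schrodingerEq_smul μ e).2 (hf.2.1 e))
  rw [← smul_sub] at h1
  have h2 := sub_eq_zero.1 (hinj _ h1)
  rw [h2] at hu'
  refine vertexValue_congr (fun e => ?_) _
  exact Measure.eqOn_Icc_of_ae_eq volume (G.len_pos e).ne ((hu' e).symm.trans (hu e))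
    (hg.1.1 e).1.continuousOn (hf.1.1 e).1.continuousOn

end MetricGraph

/-! ### Unique continuation -/

namespace MetricGraph

section UniqueContinuation

variable {V E : Type*} {G : MetricGraph V E} [Fintype E]

/-- If the function vanishes at a vertex and on the edges there, except at a single edge endpoint, the
vertex condition makes its derivative vanish at that endpoint too, and hence the function on the
remaining edge. -/
theorem eqOn_zero_of_degreeIn_eq_one {q : E → ℝ → ℝ}
    (hq : ∀ e, IntegrableOn (q e) (Icc 0 (G.len e))) {μ : ℂ} {f : E → ℝ → ℂ} (hf : G.IsContAC2 f)
    (heq : ∀ e, SchrodingerEq (G.len e) (q e) (f e) (fun t => μ * f e t)) {S : Set E}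
    (hS : ∀ e, e ∉ S → EqOn (f e) 0 (Icc 0 (G.len e))) {v : V} (hval : G.vertexValue f v = 0)
    (hder : G.normalDeriv f v = 0) (hdeg : G.degreeIn S v = 1) :
    ∃ e ∈ S, EqOn (f e) 0 (Icc 0 (G.len e)) := by
  obtain ⟨p, hp⟩ := Set.ncard_eq_one.1 hdeg
  have hpm : G.vertexOf p = v ∧ Sum.elim id id p ∈ S := by
    have h : p ∈ ({p} : Set (E ⊕ E)) := rfl
    rwa [← hp] at h
  have huniq : ∀ p', G.vertexOf p' = v → Sum.elim id id p' ∈ S → p' = p := by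
    intro p' h1 h2
    have h : p' ∈ {p : E ⊕ E | G.vertexOf p = v ∧ Sum.elim id id p ∈ S} := ⟨h1, h2⟩
    rwa [hp] at h
  have hder0 : ∀ e, e ∉ S → ∀ x ∈ Icc 0 (G.len e), edgeDeriv (G.len e) (f e) x = 0 :=
    fun e he x hx => (edgeDeriv_eqOn (hS e he) hx).trans
      (edgeDeriv_eq_of_hasDerivAt (G.len_pos e) hx (hasDerivAt_const _ _))
  have hl : ∀ e, (0 : ℝ) ∈ Icc 0 (G.len e) := fun e => left_mem_Icc.2 (G.len_pos e).le
  have hr : ∀ e, G.len e ∈ Icc 0 (G.len e) := fun e => right_mem_Icc.2 (G.len_pos e).le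
  have hend := G.endValue_eq_vertexValue hf.2 p
  rw [hpm.1, hval] at hend
  classical
  rw [normalDeriv] at hder
  rcases p with e | e
  · have h1 : ∑ e' with G.t e' = v, edgeDeriv (G.len e') (f e') (G.len e') = 0 := by
      refine Finset.sum_eq_zero fun e' he' => hder0 e' (fun hs => ?_) _ (hr e')
      cases huniq (Sum.inr e') (Finset.mem_filter.1 he').2 hs
    have h2 : ∑ e' with G.o e' = v, edgeDeriv (G.len e') (f e') 0 =
        edgeDeriv (G.len e) (f e) 0 := by
      refine Finset.sum_eq_single_of_mem e (Finset.mem_filter.2 ⟨Finset.mem_univ _, hpm.1⟩)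
        fun e' he' hne => hder0 e' (fun hs => hne ?_) _ (hl e')
      exact Sum.inl_injective (huniq (Sum.inl e') (Finset.mem_filter.1 he').2 hs)
    exact ⟨e, hpm.2, SchrodingerEq.eqOn_zero_of_left (G.len_pos e) (hq e) (hf.1 e) (heq e) hend
      (by rw [← h2]; linear_combination h1 - hder)⟩
  · have h1 : ∑ e' with G.o e' = v, edgeDeriv (G.len e') (f e') 0 = 0 := by
      refine Finset.sum_eq_zero fun e' he' => hder0 e' (fun hs => ?_) _ (hl e')
      cases huniq (Sum.inl e') (Finset.mem_filter.1 he').2 hs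
    have h2 : ∑ e' with G.t e' = v, edgeDeriv (G.len e') (f e') (G.len e') =
        edgeDeriv (G.len e) (f e) (G.len e) := by
      refine Finset.sum_eq_single_of_mem e (Finset.mem_filter.2 ⟨Finset.mem_univ _, hpm.1⟩)
        fun e' he' hne => hder0 e' (fun hs => hne ?_) _ (hr e')
      exact Sum.inr_injective (huniq (Sum.inr e') (Finset.mem_filter.1 he').2 hs)
    exact ⟨e, hpm.2, SchrodingerEq.eqOn_zero_of_right (G.len_pos e) (hq e) (hf.1 e) (heq e) hend
      (by rw [← h2]; linear_combination h1 + hder)⟩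

/-- Away from resonances an eigenfunction is determined by its values on `B`. If it vanishes on `B`,
the edges that carry it form a subgraph without vertices of degree one. This subgraph lies in the
core, so the eigenfunction vanishes at all vertices, and a cycle in the subgraph is a resonance. -/
theorem eqOn_zero_of_vertexValue_eq_zero [Finite V] {q : E → ℝ → ℝ}
    (hq : ∀ e, IntegrableOn (q e) (Icc 0 (G.len e))) {α : V → ℝ} {B : Finset V}
    (hboundary : ∀ v, G.IsBoundary v → v ∈ B) (hcore : ∀ v, G.IsProperCore v → v ∈ B) {lam : ℝ}
    (hlam : ¬ G.IsResonance q lam) {f : E → ℝ → ℂ} (hf : G.IsContAC2 f)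
    (hrobin : ∀ v, G.robinData α f v = 0)
    (heq : ∀ e, SchrodingerEq (G.len e) (q e) (f e) (fun t => (lam : ℂ) * f e t))
    (hB : ∀ v ∈ B, G.vertexValue f v = 0) (e : E) : EqOn (f e) 0 (Icc 0 (G.len e)) := by
  set S : Set E := {e | ¬ EqOn (f e) 0 (Icc 0 (G.len e))} with hS
  have hmem : ∀ p, G.vertexValue f (G.vertexOf p) ≠ 0 → Sum.elim id id p ∈ S := by
    intro p hp h
    rw [← G.endValue_eq_vertexValue hf.2 p] at hp
    rcases p with e | e
    · exact hp (h (left_mem_Icc.2 (G.len_pos e).le))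
    · exact hp (h (right_mem_Icc.2 (G.len_pos e).le))
  have hdeg : G.NoDegreeOne S := by
    intro v hv
    by_cases hval : G.vertexValue f v = 0
    · have hder : G.normalDeriv f v = 0 := by
        have := hrobin v
        rwa [robinData, hval, mul_zero, sub_zero] at this
      obtain ⟨e, he, h⟩ := eqOn_zero_of_degreeIn_eq_one hq hf heq
        (fun e he => not_not.1 he) hval hder hv
      exact he h
    · refine hval (hB v (hboundary v ?_))
      rw [IsBoundary, ← hv, degree, degreeIn]
      congr 1
      ext p
      exact ⟨fun h => ⟨h, hmem p (by rwa [show G.vertexOf p = v from h])⟩, fun h => h.1⟩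
  have hval : ∀ v, G.vertexValue f v = 0 := by
    intro v
    by_contra hv
    refine hv (hB v (hcore v fun e he => ⟨S, hdeg, ?_⟩))
    rcases he with rfl | rfl
    · exact hmem (Sum.inl e) hv
    · exact hmem (Sum.inr e) hv
  by_contra he
  obtain ⟨n, v, c, hc, hcS⟩ := G.exists_isCycle_of_noDegreeOne hdeg ⟨e, he⟩
  refine hlam ⟨n, v, c, hc, fun i => ⟨f (c i), hf.1 _, ?_, ?_, heq _, ?_⟩⟩
  · exact (G.endValue_eq_vertexValue hf.2 (Sum.inl (c i))).trans (hval _)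
  · exact (G.endValue_eq_vertexValue hf.2 (Sum.inr (c i))).trans (hval _)
  · have h := hcS i
    simp only [hS, Set.mem_ofPred_eq, EqOn, not_forall] at h
    obtain ⟨x, hx, h⟩ := h
    exact ⟨x, hx, h⟩

end UniqueContinuation

end MetricGraph

/-! ### Matrix functions with a simple pole -/

section Laurent

variable {m : Type*} {M F : ℂ → Matrix m m ℂ} {C : Matrix m m ℂ} {z₀ : ℂ} {r : ℝ}

theorem analyticNearPunctured_of_simplePole (hr : 0 < r)
    (hF : ∀ k l, DifferentiableOn ℂ (fun z => F z k l) (Metric.ball z₀ r))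
    (hM : ∀ z ∈ Metric.ball z₀ r, z ≠ z₀ → M z = F z + (z - z₀)⁻¹ • C) :
    AnalyticNearPunctured M z₀ := by
  filter_upwards [self_mem_nhdsWithin, mem_nhdsWithin_of_mem_nhds (Metric.ball_mem_nhds z₀ hr)]
    with z hz hzr k l
  have hz' : z - z₀ ≠ 0 := sub_ne_zero.2 hz
  have hFa : AnalyticAt ℂ (fun z => F z k l) z :=
    (hF k l).analyticAt (Metric.isOpen_ball.mem_nhds hzr)
  have h : AnalyticAt ℂ (fun w => F w k l + (w - z₀)⁻¹ * C k l) z :=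
    hFa.add (((analyticAt_id.sub analyticAt_const).inv hz').mul analyticAt_const)
  refine h.congr ?_
  filter_upwards [Metric.isOpen_ball.mem_nhds hzr, isOpen_ne.mem_nhds hz] with w hw hwne
  rw [hM w hw hwne]
  rfl

theorem isMatrixPole_iff_of_simplePole (hr : 0 < r)
    (hF : ∀ k l, DifferentiableOn ℂ (fun z => F z k l) (Metric.ball z₀ r))
    (hM : ∀ z ∈ Metric.ball z₀ r, z ≠ z₀ → M z = F z + (z - z₀)⁻¹ • C) :
    IsMatrixPole M z₀ ↔ C ≠ 0 := by
  have hpow : ∀ n : ℕ, 1 ≤ n → Tendsto (fun z => (z - z₀) ^ n • F z) (𝓝[≠] z₀) (𝓝 0) := by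
    intro n hn
    refine tendsto_pi_nhds.2 fun k => tendsto_pi_nhds.2 fun l => ?_
    have h1 : ContinuousAt (fun z => (z - z₀) ^ n * F z k l) z₀ :=
      ((continuousAt_id.sub continuousAt_const).pow n).mul
        ((hF k l).continuousOn.continuousAt (Metric.ball_mem_nhds z₀ hr))
    have h2 := h1.tendsto
    simp only [sub_self, zero_pow (by omega : n ≠ 0), zero_mul] at h2
    exact h2.mono_left nhdsWithin_le_nhds
  have hev : ∀ᶠ z in 𝓝[≠] z₀, z ≠ z₀ ∧ z ∈ Metric.ball z₀ r := by
    filter_upwards [self_mem_nhdsWithin, mem_nhdsWithin_of_mem_nhds (Metric.ball_mem_nhds z₀ hr)]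
      with z hz hzr using ⟨hz, hzr⟩
  constructor
  · rintro ⟨-, n, hn, R, hR, hlim⟩ rfl
    refine hR (tendsto_nhds_unique hlim ((hpow n hn).congr' ?_))
    filter_upwards [hev] with z hz
    rw [hM z hz.2 hz.1, smul_zero, add_zero]
  · intro hC
    refine ⟨analyticNearPunctured_of_simplePole hr hF hM, 1, le_rfl, C, hC, ?_⟩
    have h := (hpow 1 le_rfl).add_const C
    rw [zero_add] at h
    refine h.congr' ?_
    filter_upwards [hev] with z hz
    rw [hM z hz.2 hz.1, smul_add, smul_smul, pow_one, mul_inv_cancel₀ (sub_ne_zero.2 hz.1),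
      one_smul]

theorem hasMatrixResidue_of_simplePole (hr : 0 < r)
    (hF : ∀ k l, DifferentiableOn ℂ (fun z => F z k l) (Metric.ball z₀ r))
    (hM : ∀ z ∈ Metric.ball z₀ r, z ≠ z₀ → M z = F z + (z - z₀)⁻¹ • C) :
    HasMatrixResidue M z₀ C := by
  refine ⟨analyticNearPunctured_of_simplePole hr hF hM, ?_⟩
  filter_upwards [Ioo_mem_nhdsGT hr] with ρ hρ k l
  have hsub : Metric.closedBall z₀ ρ ⊆ Metric.ball z₀ r := Metric.closedBall_subset_ball hρ.2
  have hne : ∀ z ∈ Metric.sphere z₀ ρ, z ≠ z₀ := fun z hz h => by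
    rw [h, mem_sphere_iff_norm, sub_self, norm_zero] at hz
    exact hρ.1.ne hz
  have hcF : ContinuousOn (fun z => F z k l) (Metric.closedBall z₀ ρ) :=
    (hF k l).continuousOn.mono hsub
  have hiF : CircleIntegrable (fun z => F z k l) z₀ ρ :=
    (hcF.mono Metric.sphere_subset_closedBall).circleIntegrable hρ.1.le
  have hiC : CircleIntegrable (fun z => (z - z₀)⁻¹ * C k l) z₀ ρ := by
    refine ContinuousOn.circleIntegrable hρ.1.le (ContinuousOn.mul (ContinuousOn.inv₀ ?_ ?_) ?_)
    · fun_prop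
    · exact fun z hz => sub_ne_zero.2 (hne z hz)
    · fun_prop
  have hcongr : EqOn (fun z => F z k l + (z - z₀)⁻¹ * C k l) (fun z => M z k l)
      (Metric.sphere z₀ ρ) := fun z hz => by
    simp only [hM z (hsub (Metric.sphere_subset_closedBall hz)) (hne z hz)]
    rfl
  refine ⟨(hiF.add hiC).congr fun θ _ => hcongr (circleMap_mem_sphere z₀ hρ.1.le θ), ?_⟩
  rw [← circleIntegral.integral_congr hρ.1.le hcongr, circleIntegral.integral_add hiF hiC,
    Complex.circleIntegral_eq_zero_of_differentiable_on_off_countable hρ.1.le countable_empty hcF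
      fun z hz => (hF k l).differentiableAt
        (Metric.isOpen_ball.mem_nhds (hsub (Metric.ball_subset_closedBall hz.1))), zero_add]
  have h1 : (∮ z in C(z₀, ρ), (z - z₀)⁻¹ * C k l) = (2 * Real.pi * Complex.I) * C k l := by
    have := circleIntegral.integral_smul_const (fun z => (z - z₀)⁻¹) (C k l) z₀ ρ
    simp only [smul_eq_mul] at this
    rw [this, circleIntegral.integral_sub_center_inv z₀ hρ.1.ne']
  rw [h1, inv_mul_cancel_left₀ Complex.two_pi_I_ne_zero]

end Laurent

/-! ### The Laurent expansion of the Titchmarsh-Weyl function -/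

namespace MetricGraph

variable {V E : Type*} {G : MetricGraph V E} [Fintype V] [Fintype E] {q : E → ℝ → ℝ} {α : V → ℝ}

/-- Green's identity for two Weyl solutions, the first one at a real point. -/
theorem vertexValue_weyl_eq (hq : ∀ e, IntegrableOn (q e) (Icc 0 (G.len e))) {ν : ℝ} {μ : ℂ}
    {k l : V} {f g : E → ℝ → ℂ} (hf : G.IsWeylSolution q α ν k f) (hg : G.IsWeylSolution q α μ l g)
    {u u' : G.L2} (hu : Represents u f) (hu' : Represents u' g) :
    G.vertexValue g k = conj (G.vertexValue f l) + (μ - ν) * inner ℂ u u' := by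
  classical
  have h := inner_green hq α hf.1 hg.1 hu hu' (fun e => (hu.schrodingerEq_smul _ e).2 (hf.2.1 e))
    (fun e => (hu'.schrodingerEq_smul _ e).2 (hg.2.1 e))
  simp only [hf.robinData, hg.robinData, inner_smul_left, inner_smul_right, Complex.conj_ofReal,
    Finset.sum_sub_distrib, apply_ite conj, map_one, map_zero, mul_ite, ite_mul, mul_one, mul_zero,
    one_mul, zero_mul, Finset.sum_ite_eq', Finset.mem_univ, if_true] at h
  linear_combination h

/-- Green's identity for a Weyl solution at a real point and an eigenfunction. -/
theorem vertexValue_eigenfunction_eq (hq : ∀ e, IntegrableOn (q e) (Icc 0 (G.len e)))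
    {ν : ℝ} {μ : ℂ} {k : V} {f g : E → ℝ → ℂ} (hf : G.IsWeylSolution q α ν k f)
    (hg : G.IsContAC2 g) (hrobin : ∀ v, G.robinData α g v = 0)
    (heq : ∀ e, SchrodingerEq (G.len e) (q e) (g e) (fun t => μ * g e t))
    {u u' : G.L2} (hu : Represents u f) (hu' : Represents u' g) :
    G.vertexValue g k = (μ - ν) * inner ℂ u u' := by
  classical
  have h := inner_green hq α hf.1 hg hu hu' (fun e => (hu.schrodingerEq_smul _ e).2 (hf.2.1 e))
    (fun e => (hu'.schrodingerEq_smul _ e).2 (heq e))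
  simp only [hf.robinData, hrobin, inner_smul_left, inner_smul_right, Complex.conj_ofReal,
    Finset.sum_sub_distrib, apply_ite conj, map_one, map_zero, mul_zero, ite_mul,
    one_mul, zero_mul, Finset.sum_ite_eq', Finset.mem_univ, if_true, Finset.sum_const_zero] at h
  linear_combination h

end MetricGraph

open scoped ComplexOrder in
theorem Matrix.rank_neg_mul_conjTranspose_of_injective {m n : Type*} [Fintype m] [Fintype n]
    (Φ : Matrix m n ℂ) (h : ∀ c, Φ.mulVec c = 0 → c = 0) :
    (-(Φ * Φ.conjTranspose)).rank = Fintype.card n := by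
  have h1 : (-(Φ * Φ.conjTranspose)).rank = (Φ * Φ.conjTranspose).rank := by
    have : (-(Φ * Φ.conjTranspose)).mulVecLin = -(Φ * Φ.conjTranspose).mulVecLin := by
      ext
      simp
    rw [Matrix.rank, Matrix.rank, this, LinearMap.range_neg]
  rw [h1, Matrix.rank_self_mul_conjTranspose, Matrix.rank, LinearMap.finrank_range_of_inj,
    Module.finrank_fintype_fun_eq_card]
  exact (injective_iff_map_eq_zero _).2 h

namespace MetricGraph

variable {V E : Type*} {G : MetricGraph V E} [Fintype V] [Fintype E] {q : E → ℝ → ℝ} {α : V → ℝ}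

/-- Laurent expansion at `lam`: the Titchmarsh-Weyl function has at most a simple pole with residue
`-Φ Φᴴ`, where the columns of `Φ` hold the values on `B` of an orthonormal basis of the
eigenspace. -/
theorem exists_laurent_titchmarshWeyl (hq : ∀ e, IntegrableOn (q e) (Icc 0 (G.len e)))
    {B : Finset V} (hboundary : ∀ v, G.IsBoundary v → v ∈ B)
    (hcore : ∀ v, G.IsProperCore v → v ∈ B) {lam : ℝ} (hlam : ¬ G.IsResonance q lam) :
    ∃ (F : ℂ → Matrix B B ℂ) (C : Matrix B B ℂ) (r : ℝ), 0 < r ∧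
      (∀ k l, DifferentiableOn ℂ (fun z => F z k l) (Metric.ball (lam : ℂ) r)) ∧
      (∀ z ∈ Metric.ball (lam : ℂ) r, z ≠ lam →
        G.titchmarshWeyl q α B z = F z + (z - lam)⁻¹ • C) ∧
      Module.rank ℂ (G.eigenspace q α (lam : ℂ)) = (C.rank : Cardinal) := by
  set Γ := G.schrodingerGraph q α with hΓ
  set K := G.eigenspace q α (lam : ℂ) with hK
  obtain ⟨hfin, hF⟩ := eigenspace_fredholm (α := α) hq lam
  have hsymm := schrodingerGraph_symm (α := α) hq
  have hKmem : ∀ u, u ∈ K ↔ (u, (lam : ℂ) • u) ∈ Γ := fun u => mem_eigenspace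
  obtain ⟨S, hS1, hS2, hS3⟩ := exists_reducedResolvent Γ hsymm lam K hKmem hF
  -- On this ball around `lam` the Neumann series for `(1 - (z - lam) • S)⁻¹` converges.
  set r : ℝ := (‖S‖ + 1)⁻¹ with hr
  have hr0 : 0 < r := by positivity
  have hunit : ∀ z ∈ Metric.ball (lam : ℂ) r, IsUnit (1 - (z - (lam : ℂ)) • S) := by
    intro z hz
    refine isUnit_one_sub_of_norm_lt_one ?_
    rw [norm_smul]
    rw [mem_ball_iff_norm, hr] at hz
    have h1 := mul_lt_mul_of_pos_right hz (by positivity : 0 < ‖S‖ + 1)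
    rw [inv_mul_cancel₀ (by positivity)] at h1
    nlinarith [norm_nonneg (z - (lam : ℂ))]
  have hR := fun z (hz : z ∈ Metric.ball (lam : ℂ) r) (hne : z ≠ lam) =>
    resolventOf_spec Γ hsymm lam K hKmem S hS1 hS2 hS3 hne (hunit z hz)
  have hinj : ∀ z ∈ Metric.ball (lam : ℂ) r, z ≠ lam → ∀ u, (u, z • u) ∈ Γ → u = 0 := by
    intro z hz hne u hu
    have := (hR z hz hne).2 u 0 (by rwa [zero_add])
    rw [← this, map_zero]
  -- A real base point in the resolvent set.
  set ν : ℝ := lam + r / 2 with hν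
  have hνball : (ν : ℂ) ∈ Metric.ball (lam : ℂ) r := by
    rw [mem_ball_iff_norm, hν, ← Complex.ofReal_sub, Complex.norm_real, add_sub_cancel_left,
      Real.norm_of_nonneg (by positivity)]
    linarith
  have hνne : (ν : ℂ) ≠ lam := by
    rw [hν, Ne, Complex.ofReal_inj]
    linarith
  choose f hf using fun l : V => exists_isWeylSolution (α := α) hq (hinj ν hνball hνne) l
  let h : V → G.L2 := fun l => G.toL2 (f l) (hf l).1.1
  have hh : ∀ l, Represents (h l) (f l) := fun l => represents_toL2 (hf l).1.1
  let N : ℂ → G.L2 →L[ℂ] G.L2 := fun z => S * Ring.inverse (1 - (z - (lam : ℂ)) • S)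
  have hN : DifferentiableOn ℂ N (Metric.ball (lam : ℂ) r) := by
    intro z hz
    have h1 : DifferentiableAt ℂ (fun z : ℂ => 1 - (z - (lam : ℂ)) • S) z := by fun_prop
    have h2 := (differentiableAt_inverse (𝕜 := ℂ) (hunit z hz)).comp z h1
    exact (h2.const_mul S).differentiableWithinAt
  let D : B → B → ℂ := fun k l => inner ℂ (h k) (K.starProjection (h l))
  let C : Matrix B B ℂ := Matrix.of fun k l => -((lam : ℂ) - ν) ^ 2 * D k l
  let F : ℂ → Matrix B B ℂ := fun z => Matrix.of fun k l =>
    conj (G.vertexValue (f k) l) + (z - ν) * inner ℂ (h k) (h l) - (z + lam - 2 * ν) * D k l +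
      (z - ν) ^ 2 * inner ℂ (h k) (N z (h l))
  refine ⟨F, C, r, hr0, fun k l => ?_, fun z hz hne => ?_, ?_⟩
  · have h1 : DifferentiableOn ℂ (fun z => inner ℂ (h k) (N z (h l))) (Metric.ball (lam : ℂ) r) :=
      ((innerSL ℂ (h k)).differentiable.comp_differentiableOn
        (hN.clm_apply (differentiableOn_const _)))
    simp only [F, Matrix.of_apply]
    have h2 : Differentiable ℂ fun z : ℂ => (z - ν) ^ 2 := by fun_prop
    have h3 : Differentiable ℂ fun z : ℂ => conj (G.vertexValue (f k) l) +
      (z - ν) * inner ℂ (h k) (h l) - (z + lam - 2 * ν) * D k l := by fun_prop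
    exact h3.differentiableOn.add (h2.differentiableOn.mul h1)
  · ext k l
    obtain ⟨g, hg⟩ := exists_isWeylSolution (α := α) hq (hinj z hz hne) (l : V)
    rw [titchmarshWeyl_apply (mem_resolventSet (hR z hz hne).1 (hR z hz hne).2) (hinj z hz hne)
      k l hg]
    have hu := represents_toL2 hg.1.1
    set u := G.toL2 g hg.1.1
    rw [vertexValue_weyl_eq hq (hf k) hg (hh k) hu]
    have h1 := sub_mem_schrodingerGraph hg.1 (hf l).1
      (fun v => (hg.robinData v).trans ((hf l).robinData v).symm) hu (hh l)
      (fun e => (hu.schrodingerEq_smul z e).2 (hg.2.1 e))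
      (fun e => ((hh l).schrodingerEq_smul ν e).2 ((hf l).2.1 e))
    have h2 := (hR z hz hne).2 (u - h l) ((z - ν) • h l) (by
      convert h1 using 2
      module)
    have h3 : u = h l + (z - ν) • (((lam : ℂ) - z)⁻¹ • K.starProjection (h l) + N z (h l)) := by
      rw [← sub_eq_iff_eq_add', ← h2, map_smul]
      rfl
    rw [h3]
    simp only [inner_add_right, inner_smul_right, F, C, D, Matrix.add_apply, Matrix.smul_apply,
      Matrix.of_apply, smul_eq_mul]
    have h4 : (lam : ℂ) - z ≠ 0 := sub_ne_zero.2 hne.symm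
    have h5 : z - (lam : ℂ) ≠ 0 := sub_ne_zero.2 hne
    rw [← neg_sub z (lam : ℂ), inv_neg]
    field_simp
    ring
  · let b := stdOrthonormalBasis ℂ K
    let Φ : Matrix B (Fin (Module.finrank ℂ K)) ℂ :=
      Matrix.of fun k i => ((lam : ℂ) - ν) * inner ℂ (h k) (b i : G.L2)
    have hC : C = -(Φ * Φ.conjTranspose) := by
      ext k l
      simp only [C, D, Φ, Matrix.of_apply, Matrix.neg_apply, Matrix.mul_apply,
        Matrix.conjTranspose_apply, b.starProjection_eq_sum_rankOne,
        sum_apply, InnerProductSpace.rankOne_apply, inner_sum,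
        inner_smul_right, Finset.mul_sum, star_mul', RCLike.star_def, inner_conj_symm, map_sub,
        Complex.conj_ofReal, ← Finset.sum_neg_distrib]
      refine Finset.sum_congr rfl fun i _ => ?_
      ring
    have hΦ : ∀ c, Φ.mulVec c = 0 → c = 0 := by
      intro c hc
      set u : K := ∑ i, c i • b i with hu
      have hval : ∀ k : B, ((lam : ℂ) - ν) * inner ℂ (h k) (u : G.L2) = 0 := by
        intro k
        have := congrFun hc k
        simp only [Matrix.mulVec, dotProduct, Φ, Matrix.of_apply, Pi.zero_apply] at this
        rw [← this, hu]
        simp only [Submodule.coe_sum, Submodule.coe_smul, inner_sum, inner_smul_right,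
          Finset.mul_sum]
        refine Finset.sum_congr rfl fun i _ => ?_
        ring
      obtain ⟨g, hg, hrobin, hrep, heq⟩ := mem_schrodingerGraph_smul_iff.1 u.2
      have hzero := eqOn_zero_of_vertexValue_eq_zero hq hboundary hcore hlam hg hrobin heq
        fun v hv => by
          rw [vertexValue_eigenfunction_eq hq (hf v) hg hrobin heq (hh v) hrep]
          exact hval ⟨v, hv⟩
      have hu0 : u = 0 := by
        refine Subtype.ext (hrep.eq fun e => ?_)
        refine (Lp.coeFn_zero ℂ 2 (volume.restrict (Icc 0 (G.len e)))).trans ?_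
        exact (ae_restrict_iff' measurableSet_Icc).2 (ae_of_all _ fun x hx => (hzero e hx).symm)
      funext i
      exact Fintype.linearIndependent_iff.1 b.orthonormal.linearIndependent c
        (hu.symm.trans hu0) i
    rw [hC, Matrix.rank_neg_mul_conjTranspose_of_injective Φ hΦ, Fintype.card_fin,
      Module.finrank_eq_rank]

end MetricGraph

theorem Matrix.rank_eq_zero_iff {m n : Type*} [Finite m] [Fintype n] (C : Matrix m n ℂ) :
    C.rank = 0 ↔ C = 0 := by
  classical
  rw [Matrix.rank, Submodule.finrank_eq_zero, LinearMap.range_eq_bot, ← Matrix.toLin'_apply',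
    LinearEquiv.map_eq_zero_iff]

theorem mainTheorem2 {V E : Type*} [Fintype V] [Fintype E] (G : MetricGraph V E)
    (q : E → ℝ → ℝ) (hq : ∀ e, IntegrableOn (q e) (Icc 0 (G.len e)))
    (α : V → ℝ) (B : Finset V)
    (hboundary : ∀ v, G.IsBoundary v → v ∈ B)
    (hcore : ∀ v, G.IsProperCore v → v ∈ B)
    (lam : ℝ) (hlam : ¬ G.IsResonance q lam) :
    ((G.schrodingerOp q α).IsEigenvalue (lam : ℂ) ↔
      IsMatrixPole (G.titchmarshWeyl q α B) (lam : ℂ)) ∧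
    ∃ R : Matrix B B ℂ, HasMatrixResidue (G.titchmarshWeyl q α B) (lam : ℂ) R ∧
      Module.rank ℂ ((G.schrodingerOp q α).kerSub (lam : ℂ)) = (R.rank : Cardinal) := by
  obtain ⟨F, C, r, hr, hF, hM, hrank⟩ :=
    MetricGraph.exists_laurent_titchmarshWeyl (α := α) hq hboundary hcore hlam
  rw [← MetricGraph.rank_kerSub] at hrank
  refine ⟨?_, C, hasMatrixResidue_of_simplePole hr hF hM, hrank⟩
  rw [isMatrixPole_iff_of_simplePole hr hF hM, LinearPMap.IsEigenvalue, not_iff_not]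
  rw [← Submodule.rank_eq_zero, hrank, Nat.cast_eq_zero, C.rank_eq_zero_iff]
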